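/- Let $d\ge 3$. Let $P_x$ be the law of discrete time simple random walk $(X_n)_{n\ge 0}$ on $\mathbb{Z}^d$ started at $x$, let $g(x,y)=\sum_{n\ge 0}P_x[X_n=y]$ be its Green function, and for a finite set $A\subset\mathbb{Z}^d$ let $e_A(x)=P_x[X_n\notin A\text{ for all }n\ge 1]\,1_A(x)$ be its equilibrium measure and $\mathrm{cap}(A)=\sum_{x\in A}e_A(x)$ its capacity. Let $\varphi=(\varphi_x)_{x\in\mathbb{Z}^d}$ be the Gaussian free field, that is, a centered Gaussian field with covariance $\mathbb{E}[\varphi_x\varphi_y]=g(x,y)$, under a probability $\mathbb{P}$. For integers $L\ge 1$, $K\ge 100$ and $z\in L\mathbb{Z}^d$, let $B_z=z+[0,L)^d$, $D_z=z+[-3L,4L)^d$, $U_z=z+[-KL+1,L+KL-1)^d$ (boxes in $\mathbb{Z}^d$), and let $$h^z_x=E_x[\varphi_{X_{T}}],\qquad T=\inf\{n\ge 0:\ X_n\notin U_z\},$$ be the harmonic average of $\varphi$ attached to $B_z$. Let $\mathcal{C}$ denote a non-empty finite subset of $L\mathbb{Z}^d$ whose points are at mutual $\ell^\infty$-distance at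 least $L+2KL$. Put $C=\bigcup_{z\in\mathcal{C}}B_z$, $\lambda(z)=e_C(B_z)/\mathrm{cap}(C)$, let $\mathcal{F}$ be the set of functions $f:\mathcal{C}\to\mathbb{Z}^d$ with $f(z)\in D_z$ for all $z\in\mathcal{C}$, and set $$Z_f=\sum_{z\in\mathcal{C}}\lambda(z)\,h^z_{f(z)}\quad(f\in\mathcal{F}),\qquad Z=\inf_{f\in\mathcal{F}}Z_f .$$ Theorem 4.2. There are a function $\alpha(\cdot)$ and a constant $c_4>0$, depending only on $d$, with $\alpha(K)>1$ for all integers $K\ge 100$ and $\lim_{K\to\infty}\alpha(K)=1$, such that for every integer $K\ge 100$ $$\limsup_{L\to\infty}\ \sup_{\mathcal{C}}\ \sup_{f\in\mathcal{F}}\ \mathrm{var}(Z_f)\,\mathrm{cap}(C)<\alpha(K),$$ and such that for all integers $L\ge 1$, $K\ge 100$ and all $\mathcal{C}$ as above, $Z$ is integrable and $$|\mathbb{E}[Z]|\le\frac{c_4}{K}\sqrt{\frac{|\mathcal{C}|}{\mathrm{cap}(C)}} .$$ -/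

import Mathlib

open MeasureTheory ProbabilityTheory Filter Topology
open scoped ENNReal

noncomputable section

namespace GFF

/-- The lattice `ℤ^d`. Its norm `‖·‖` is the `ℓ^∞`-norm, its measurable structure the discrete one. -/
abbrev Lat (d : ℕ) : Type := Fin d → ℤ

/-! ### Simple random walk -/

/-- The `2d` unit vectors of `ℤ^d`: `(i, true) ↦ e_i` and `(i, false) ↦ -e_i`. -/
def unitStep {d : ℕ} (s : Fin d × Bool) : Lat d :=
  Pi.single s.1 (if s.2 then 1 else -1)

/-- The position at time `n` of the path that starts in `x` and has increments `unitStep (ξ i)`. -/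
def walkPos {d : ℕ} (x : Lat d) (ξ : ℕ → Fin d × Bool) (n : ℕ) : Lat d :=
  x + ∑ i ∈ Finset.range n, unitStep (ξ i)

/-- The canonical law `P_x` on `(ℤ^d)^ℕ` of simple random walk starting in `x`: the increments are
independent and uniformly distributed over the `2d` unit vectors. -/
def walkLaw {d : ℕ} [NeZero d] (x : Lat d) : Measure (ℕ → Lat d) :=
  (Measure.infinitePi fun _ : ℕ => (PMF.uniformOfFintype (Fin d × Bool)).toMeasure).map (walkPos x)

/-- The Green function `g(x, y) = ∑_{n ≥ 0} P_x[X_n = y]`. -/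
def green {d : ℕ} [NeZero d] (x y : Lat d) : ℝ :=
  ∑' n : ℕ, (walkLaw x).real {w | w n = y}

/-- The equilibrium measure `e_A(x) = P_x[X_n ∉ A for all n ≥ 1] 1_A(x)` of a finite set `A`. -/
def equilibrium {d : ℕ} [NeZero d] (A : Finset (Lat d)) (x : Lat d) : ℝ :=
  if x ∈ A then (walkLaw x).real {w | ∀ n : ℕ, 1 ≤ n → w n ∉ A} else 0

/-- The capacity of a finite set, i.e. the total mass of its equilibrium measure. -/
def capacity {d : ℕ} [NeZero d] (A : Finset (Lat d)) : ℝ :=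
  ∑ x ∈ A, equilibrium A x

/-- The exit time `T_U = inf {n ≥ 0 : X_n ∉ U}` (with value `0` on the paths that never leave `U`,
which form a null set when `U` is finite). -/
def exitTime {d : ℕ} (U : Finset (Lat d)) (w : ℕ → Lat d) : ℕ :=
  sInf {n : ℕ | w n ∉ U}

/-! ### The Gaussian free field and its harmonic averages -/

/-- `φ` is a Gaussian free field on `ℤ^d` under `P`: a centered Gaussian field whose covariance is
the Green function. -/
structure IsGaussianFreeField {d : ℕ} [NeZero d] {Ω : Type*} [MeasurableSpace Ω]
    (φ : Lat d → Ω → ℝ) (P : Measure Ω) : Prop where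
  isGaussianProcess : IsGaussianProcess φ P
  centered : ∀ x, ∫ ω, φ x ω ∂P = 0
  covariance : ∀ x y, ∫ ω, φ x ω * φ y ω ∂P = green x y

/-- The harmonic average `h^U_x = E_x[φ_{X_{T_U}}]` in the finite set `U` of a configuration `φ`. -/
def harmonicAverage {d : ℕ} [NeZero d] (U : Finset (Lat d)) (φ : Lat d → ℝ) (x : Lat d) : ℝ :=
  ∫ w, φ (w (exitTime U w)) ∂(walkLaw x)

/-! ### Boxes and collections of boxes -/

/-- The box `z + [a, b)^d` of `ℤ^d`. -/
def cube {d : ℕ} (z : Lat d) (a b : ℤ) : Finset (Lat d) :=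
  Fintype.piFinset fun i => Finset.Ico (z i + a) (z i + b)

/-- `B_z = z + [0, L)^d`. -/
def boxB {d : ℕ} (L : ℕ) (z : Lat d) : Finset (Lat d) := cube z 0 L

/-- `D_z = z + [-3L, 4L)^d`. -/
def boxD {d : ℕ} (L : ℕ) (z : Lat d) : Finset (Lat d) := cube z (-3 * L) (4 * L)

/-- `U_z = z + [-KL + 1, L + KL - 1)^d`. -/
def boxU {d : ℕ} (L K : ℕ) (z : Lat d) : Finset (Lat d) :=
  cube z (-(K * L) + 1) (L + K * L - 1)

/-- `𝒞` is a non-empty finite subset of `L ℤ^d` whose points are at mutual `ℓ^∞`-distance at least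
`L + 2KL`. -/
structure IsWellSeparated {d : ℕ} (L K : ℕ) (𝒞 : Finset (Lat d)) : Prop where
  nonempty : 𝒞.Nonempty
  mem_lattice : ∀ z ∈ 𝒞, ∀ i, (L : ℤ) ∣ z i
  separated : ∀ z ∈ 𝒞, ∀ z' ∈ 𝒞, z ≠ z' → (L : ℝ) + 2 * K * L ≤ ‖z - z'‖

/-- `C = ⋃_{z ∈ 𝒞} B_z`. -/
def boxUnion {d : ℕ} (L : ℕ) (𝒞 : Finset (Lat d)) : Finset (Lat d) :=
  𝒞.biUnion (boxB L)

/-- `λ(z)`: the mass of `B_z` under the normalized equilibrium measure of `C`. -/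
def weight {d : ℕ} [NeZero d] (L : ℕ) (𝒞 : Finset (Lat d)) (z : Lat d) : ℝ :=
  ∑ x ∈ boxB L z, equilibrium (boxUnion L 𝒞) x / capacity (boxUnion L 𝒞)

/-- `ℱ`: the set of functions `f : 𝒞 → ℤ^d` with `f(z) ∈ D_z` for each `z ∈ 𝒞`. -/
def selections {d : ℕ} (L : ℕ) (𝒞 : Finset (Lat d)) : Finset (𝒞 → Lat d) :=
  Fintype.piFinset fun z : 𝒞 => boxD L z.1

/-- `Z_f = ∑_{z ∈ 𝒞} λ(z) h^z(f(z))`, where `h^z` is the harmonic average of `φ` in `U_z`. -/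
def Zf {d : ℕ} [NeZero d] {Ω : Type*} (φ : Lat d → Ω → ℝ) (L K : ℕ) (𝒞 : Finset (Lat d))
    (f : 𝒞 → Lat d) (ω : Ω) : ℝ :=
  ∑ z : 𝒞, weight L 𝒞 z.1 * harmonicAverage (boxU L K z.1) (fun y => φ y ω) (f z)

/-- `Z = inf_{f ∈ ℱ} Z_f` (the infimum of a finite non-empty family when `L ≥ 1`). -/
def Zinf {d : ℕ} [NeZero d] {Ω : Type*} (φ : Lat d → Ω → ℝ) (L K : ℕ) (𝒞 : Finset (Lat d))
    (ω : Ω) : ℝ :=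
  ⨅ f : selections L 𝒞, Zf φ L K 𝒞 f.1 ω

end GFF

end

noncomputable section

namespace GFF

variable {d : ℕ}

section FirstStep

/-! ### The first step of simple random walk -/

/-! Everything is reduced to three estimates for the Green function: g(x,y) is bounded above and
below by multiples of |x-y|^(2-d), and its gradient is O(|x-y|^(1-d)) (`exists_green_le`,
`exists_le_green`, `exists_green_gradient_le`). They come from comparison, not from a local limit
theorem. Shifted powers of the Euclidean norm are explicit discrete super- and subsolutions, a
dipole potential plays this role for the gradient, and `min_principle` compares them with g. The
supersolution also bounds the partial sums of the Green series, which gives transience.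

Variance. The box U_z' meets neither U_z nor its outer boundary when z and z' differ, so using
harmonicity of g in each variable gives cov(h^z_x, h^z'_x') = g(x,x')
(`IsGaussianFreeField.covariance_of_disjoint`). Moving x and x' from D_z and D_z' to arbitrary
points of B_z and B_z' costs a factor 1 + O(1/K), by the gradient bound (`exists_green_ratio_le`).
The diagonal terms are averages of g over exit points at distance of order KL, hence O(1/K) times
any value of g inside B_z (`exists_green_exit_le`). Integrating these comparisons against the
normalized equilibrium measure of C leaves 1 + O(1/K) times its energy, and that energy is 1/cap(C)
since the equilibrium potential equals 1 on C.

Expectation. Z lies below Z_f for one fixed f, a centred variable, so E[Z] ≤ 0. In the other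
direction Z ≥ Z_f - ∑ λ(z) R_z, where R_z majorizes the one-sided oscillation of h^z over D_z. The
increments of h^z there have variance O(|x-x'|/(KL)^(d-1)). Being linear in the distance, this suits
chaining with square-root scales (`exists_chaining_bound`) and gives E[R_z] = O(K⁻¹ L^(-(d-2)/2)).
The weights sum to 1, so the number of boxes enters only at the end, through cap(C) ≤ c |𝒞| L^(d-2).
-/

/-- The sequence with first entry `a` and remaining entries `u`. -/
def consSeq {α : Type*} (a : α) (u : ℕ → α) : ℕ → α
  | 0 => a
  | n + 1 => u n

@[simp] lemma consSeq_zero {α : Type*} (a : α) (u : ℕ → α) : consSeq a u 0 = a := rfl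

@[simp] lemma consSeq_succ {α : Type*} (a : α) (u : ℕ → α) (n : ℕ) :
    consSeq a u (n + 1) = u n := rfl

lemma measurable_consSeq {α : Type*} [MeasurableSpace α] :
    Measurable fun p : α × (ℕ → α) => consSeq p.1 p.2 := by
  refine measurable_pi_lambda _ fun n => ?_
  cases n with
  | zero => exact measurable_fst
  | succ n => exact (measurable_pi_apply n).comp measurable_snd

/-- A product measure is determined by its values on cylinders. Padding a cylinder with full factors
makes its index set an initial segment, where splitting off coordinate 0 is a shift of the index. -/
lemma map_consSeq_infinitePi {α : Type*} [MeasurableSpace α] (μ : Measure α)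
    [IsProbabilityMeasure μ] :
    (μ.prod (Measure.infinitePi fun _ : ℕ => μ)).map (fun p => consSeq p.1 p.2) =
      Measure.infinitePi fun _ : ℕ => μ := by
  refine Measure.eq_infinitePi _ fun s t ht => ?_
  classical
  obtain ⟨N, hN⟩ : ∃ N, s ⊆ Finset.range (N + 1) :=
    ⟨s.sup id, fun i hi => Finset.mem_range.2 (Nat.lt_succ_of_le (Finset.le_sup (f := id) hi))⟩
  set t' : ℕ → Set α := fun i => if i ∈ s then t i else Set.univ with ht'
  have hmt' : ∀ i, MeasurableSet (t' i) := fun i => by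
    by_cases hi : i ∈ s <;> simp [ht', hi, ht]
  have hprod : ∏ i ∈ s, μ (t i) = ∏ i ∈ Finset.range (N + 1), μ (t' i) := by
    rw [← Finset.prod_subset hN]
    · exact Finset.prod_congr rfl fun i hi => by simp [ht', hi]
    · intro i _ hi
      simp [ht', hi]
  have hset : (fun p : α × (ℕ → α) => consSeq p.1 p.2) ⁻¹' (Set.pi s t) =
      t' 0 ×ˢ Set.pi (Finset.range N) fun i => t' (i + 1) := by
    ext ⟨a, u⟩
    simp only [Set.mem_preimage, Set.mem_pi, Finset.mem_coe, Set.mem_prod, Finset.mem_range]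
    constructor
    · intro h
      refine ⟨?_, fun i _ => ?_⟩
      · by_cases h0 : 0 ∈ s
        · simpa [ht', h0] using h 0 h0
        · simp [ht', h0]
      · by_cases h0 : i + 1 ∈ s
        · simpa [ht', h0] using h (i + 1) h0
        · simp [ht', h0]
    · rintro ⟨h0, h1⟩ i hi
      cases i with
      | zero => simpa [ht', hi] using h0
      | succ i =>
        have := h1 i (by have := Finset.mem_range.1 (hN hi); omega)
        simpa [ht', hi] using this
  rw [Measure.map_apply measurable_consSeq (.pi s.countable_toSet fun i _ => ht i), hset,
    Measure.prod_prod, Measure.infinitePi_pi _ fun i _ => hmt' (i + 1), hprod,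
    Finset.prod_range_succ', mul_comm]


lemma walkPos_consSeq (x : Lat d) (s : Fin d × Bool) (ξ : ℕ → Fin d × Bool) :
    walkPos x (consSeq s ξ) = consSeq x (walkPos (x + unitStep s) ξ) := by
  funext n
  cases n with
  | zero => simp [walkPos]
  | succ n =>
    simp only [walkPos, consSeq_succ, Finset.sum_range_succ', consSeq_zero]
    abel

lemma measurable_walkPos (x : Lat d) : Measurable (walkPos x) := by
  refine measurable_pi_lambda _ fun n => ?_
  refine Measurable.const_add (Finset.measurable_sum _ fun i _ => ?_) x
  exact (Measurable.of_discrete (f := unitStep)).comp (measurable_pi_apply i)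

/-- The average of a function over the neighbours of a site. -/
def nbrAvg (f : Lat d → ℝ) (x : Lat d) : ℝ :=
  (∑ s : Fin d × Bool, f (x + unitStep s)) / (2 * d)

lemma nbrAvg_sub (f g : Lat d → ℝ) (x : Lat d) :
    nbrAvg (fun y => f y - g y) x = nbrAvg f x - nbrAvg g x := by
  simp [nbrAvg, Finset.sum_sub_distrib, sub_div]

lemma nbrAvg_const_mul (c : ℝ) (f : Lat d → ℝ) (x : Lat d) :
    nbrAvg (fun y => c * f y) x = c * nbrAvg f x := by
  simp [nbrAvg, ← Finset.mul_sum, mul_div_assoc]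

lemma nbrAvg_sum {ι : Type*} (S : Finset ι) (f : ι → Lat d → ℝ) (x : Lat d) :
    nbrAvg (fun y => ∑ i ∈ S, f i y) x = ∑ i ∈ S, nbrAvg (f i) x := by
  simp only [nbrAvg]
  rw [Finset.sum_comm, Finset.sum_div]

lemma nbrAvg_mono {f g : Lat d → ℝ} {x : Lat d}
    (h : ∀ s : Fin d × Bool, f (x + unitStep s) ≤ g (x + unitStep s)) :
    nbrAvg f x ≤ nbrAvg g x := by
  unfold nbrAvg
  gcongr with s _
  exact h s

lemma nbrAvg_congr {f g : Lat d → ℝ} {x : Lat d}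
    (h : ∀ s : Fin d × Bool, f (x + unitStep s) = g (x + unitStep s)) :
    nbrAvg f x = nbrAvg g x := by
  unfold nbrAvg
  simp [h]

lemma measurableSet_pos_eq (n : ℕ) (y : Lat d) : MeasurableSet {w : ℕ → Lat d | w n = y} :=
  measurableSet_eq_fun (measurable_pi_apply n) measurable_const

lemma measurableSet_pos_mem (n : ℕ) (A : Finset (Lat d)) :
    MeasurableSet {w : ℕ → Lat d | w n ∈ A} :=
  measurable_pi_apply n A.measurableSet

lemma unitStep_not (i : Fin d) (b : Bool) :
    unitStep (d := d) (i, !b) = - unitStep (d := d) (i, b) := by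
  cases b <;> simp [unitStep, ← Pi.single_neg]

variable [NeZero d]

instance (x : Lat d) : IsProbabilityMeasure (walkLaw x) :=
  Measure.isProbabilityMeasure_map (measurable_walkPos x).aemeasurable

/-- The Markov property at time one. Together with `walkLaw_start`, it is all that is used about the
dynamics of the walk from here on. -/
lemma walkLaw_real_eq (x : Lat d) {A : Set (ℕ → Lat d)} (hA : MeasurableSet A) :
    (walkLaw x).real A = nbrAvg (fun y => (walkLaw y).real {w | consSeq x w ∈ A}) x := by
  set μ : Measure (Fin d × Bool) := (PMF.uniformOfFintype (Fin d × Bool)).toMeasure with hμ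
  have hc : Measurable fun w : ℕ → Lat d => consSeq x w :=
    measurable_consSeq.comp (measurable_const.prodMk measurable_id)
  have hmeas : MeasurableSet ((fun p : (Fin d × Bool) × (ℕ → Fin d × Bool) =>
      walkPos x (consSeq p.1 p.2)) ⁻¹' A) :=
    ((measurable_walkPos x).comp measurable_consSeq) hA
  have key : walkLaw x A = ∑ s : Fin d × Bool,
      (walkLaw (x + unitStep s) {w | consSeq x w ∈ A}) * (2 * d : ℝ≥0∞)⁻¹ := by
    rw [walkLaw, ← hμ, ← map_consSeq_infinitePi μ, Measure.map_map (measurable_walkPos x)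
      measurable_consSeq, Measure.map_apply ((measurable_walkPos x).comp measurable_consSeq) hA]
    erw [Measure.prod_apply hmeas]
    rw [lintegral_fintype]
    refine Finset.sum_congr rfl fun s _ => ?_
    have h1 : μ {s} = (2 * d : ℝ≥0∞)⁻¹ := by
      rw [hμ, PMF.toMeasure_apply_singleton _ _ (measurableSet_singleton s)]
      simp [mul_comm]
    rw [h1, walkLaw, ← hμ, Measure.map_apply (measurable_walkPos _)
      (show MeasurableSet {w | consSeq x w ∈ A} from hc hA)]
    congr 2
    ext ξ
    simp [walkPos_consSeq]
  rw [nbrAvg, measureReal_def, key, ENNReal.toReal_sum, Finset.sum_div]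
  · refine Finset.sum_congr rfl fun s _ => ?_
    rw [ENNReal.toReal_mul, measureReal_def, div_eq_mul_inv]
    simp
  · intro s _
    refine ENNReal.mul_ne_top (measure_ne_top _ _) ?_
    simp [NeZero.ne d]

lemma walkLaw_start (x : Lat d) : ∀ᵐ w ∂(walkLaw x), w 0 = x := by
  rw [walkLaw, ae_map_iff (measurable_walkPos x).aemeasurable
    (measurableSet_eq_fun (measurable_pi_apply 0) measurable_const)]
  simp [walkPos]

lemma nbrAvg_const (c : ℝ) (x : Lat d) : nbrAvg (fun _ => c) x = c := by
  have : (d : ℝ) ≠ 0 := Nat.cast_ne_zero.2 (NeZero.ne d)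
  simp [nbrAvg]
  field_simp

/-! ### Transition probabilities -/

/-- The `n`-step transition probability `P_x[X_n = y]`. -/
def transProb (n : ℕ) (x y : Lat d) : ℝ := (walkLaw x).real {w | w n = y}

lemma transProb_nonneg (n : ℕ) (x y : Lat d) : 0 ≤ transProb n x y := measureReal_nonneg

lemma transProb_zero (x y : Lat d) : transProb 0 x y = if x = y then 1 else 0 := by
  unfold transProb
  have h := walkLaw_start x
  split_ifs with hxy
  · subst hxy
    rw [← probReal_univ (μ := walkLaw x)]
    refine measureReal_congr ?_
    filter_upwards [h] with w hw
    apply propext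
    change w 0 = x ↔ True
    simp [hw]
  · rw [← measureReal_empty (μ := walkLaw x)]
    refine measureReal_congr ?_
    filter_upwards [h] with w hw
    apply propext
    change w 0 = y ↔ False
    simp [hw, hxy]

lemma transProb_succ (n : ℕ) (x y : Lat d) :
    transProb (n + 1) x y = nbrAvg (fun u => transProb n u y) x := by
  unfold transProb
  rw [walkLaw_real_eq x (measurableSet_pos_eq _ _)]
  rfl

/-- An injection of the lattice that permutes the steps commutes with averaging over neighbours.
Translations, the point reflection and the coordinate reflections are the cases needed. -/
lemma transProb_map (σ : Lat d → Lat d) (hσ : Function.Injective σ)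
    (τ : Equiv.Perm (Fin d × Bool)) (h : ∀ x s, σ (x + unitStep s) = σ x + unitStep (τ s))
    (n : ℕ) (x y : Lat d) : transProb n (σ x) (σ y) = transProb n x y := by
  induction n generalizing x with
  | zero => simp [transProb_zero, hσ.eq_iff]
  | succ n ih =>
    rw [transProb_succ, transProb_succ]
    simp only [nbrAvg]
    congr 1
    rw [← Equiv.sum_comp τ]
    exact Finset.sum_congr rfl fun s _ => by rw [← h, ih]

lemma green_map (σ : Lat d → Lat d) (hσ : Function.Injective σ)
    (τ : Equiv.Perm (Fin d × Bool)) (h : ∀ x s, σ (x + unitStep s) = σ x + unitStep (τ s))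
    (x y : Lat d) : green (σ x) (σ y) = green x y :=
  tsum_congr fun n => transProb_map σ hσ τ h n x y

lemma green_add_right (x y a : Lat d) : green (x + a) (y + a) = green x y :=
  green_map (· + a) (add_left_injective a) (Equiv.refl _)
    (fun x s => by simp only [Equiv.refl_apply]; abel) x y

lemma green_neg (x y : Lat d) : green (-x) (-y) = green x y :=
  green_map (fun x => -x) neg_injective
    (Equiv.prodCongr (Equiv.refl _) Equiv.boolNot)
    (fun x s => by
      obtain ⟨i, b⟩ := s
      simp only [Equiv.prodCongr_apply, Prod.map, Equiv.refl_apply, Equiv.boolNot_apply,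
        unitStep_not]
      abel) x y

lemma green_comm (x y : Lat d) : green x y = green y x := by
  -- Negation followed by translation by `x + y` exchanges the two points.
  rw [← green_neg x y, ← green_add_right (-x) (-y) (x + y)]
  congr 1 <;> abel

lemma green_eq_sub (x y : Lat d) : green x y = green (x - y) 0 := by
  rw [← green_add_right (x - y) 0 y]
  simp

end FirstStep

/-! ### Elementary inequalities for negative powers -/

/-- All Taylor bounds below are obtained by integrating a bound on the derivative with this lemma.
-/
lemma le_of_hasDerivAt_le {A B A' B' : ℝ → ℝ} {b : ℝ}
    (hA : ∀ t, 0 ≤ t → t < b → HasDerivAt A (A' t) t)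
    (hB : ∀ t, 0 ≤ t → t < b → HasDerivAt B (B' t) t) (h0 : A 0 ≤ B 0)
    (h : ∀ t, 0 ≤ t → t < b → A' t ≤ B' t) : ∀ t, 0 ≤ t → t < b → A t ≤ B t := by
  intro t ht htb
  have hd : ∀ u ∈ Set.Icc 0 t, HasDerivAt (fun u => B u - A u) (B' u - A' u) u := fun u hu =>
    (hB u hu.1 (hu.2.trans_lt htb)).sub (hA u hu.1 (hu.2.trans_lt htb))
  have hm : MonotoneOn (fun u => B u - A u) (Set.Icc 0 t) := by
    refine monotoneOn_of_hasDerivWithinAt_nonneg (f' := fun u => B' u - A' u) (convex_Icc 0 t)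
      (fun u hu => (hd u hu).continuousAt.continuousWithinAt) (fun u hu => ?_) (fun u hu => ?_)
    · exact (hd u (interior_subset hu)).hasDerivWithinAt
    · have hu' := interior_subset hu
      exact sub_nonneg.2 (h u hu'.1 (hu'.2.trans_lt htb))
  have := hm ⟨le_rfl, ht⟩ ⟨ht, le_rfl⟩ ht
  simp only at this
  linarith

/-- The even part (times two) of `t ↦ (1 + t) ^ (-p)`. -/
def powEven (p t : ℝ) : ℝ := (1 + t) ^ (-p) + (1 - t) ^ (-p)

/-- The odd part (times minus two) of `t ↦ (1 + t) ^ (-p)`. -/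
def powOdd (p t : ℝ) : ℝ := (1 - t) ^ (-p) - (1 + t) ^ (-p)

lemma powEven_neg (p t : ℝ) : powEven p (-t) = powEven p t := by
  rw [powEven, powEven, sub_neg_eq_add, ← sub_eq_add_neg, add_comm]

lemma powEven_abs (p t : ℝ) : powEven p |t| = powEven p t := by
  rcases abs_choice t with h | h <;> rw [h]
  exact powEven_neg p t

lemma hasDerivAt_one_add_rpow (p t : ℝ) (ht : 0 ≤ t) :
    HasDerivAt (fun t : ℝ => (1 + t) ^ (-p)) (-(p * (1 + t) ^ (-(p + 1)))) t := by
  have h := ((hasDerivAt_id' t).const_add 1).rpow_const (p := -p)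
    (Or.inl (by positivity))
  convert h using 1
  rw [show -p - 1 = -(p + 1) by ring]
  ring

lemma hasDerivAt_one_sub_rpow (p t : ℝ) (ht : t < 1) :
    HasDerivAt (fun t : ℝ => (1 - t) ^ (-p)) (p * (1 - t) ^ (-(p + 1))) t := by
  have h := ((hasDerivAt_id' t).const_sub 1).rpow_const (p := -p)
    (Or.inl (by linarith))
  convert h using 1
  rw [show -p - 1 = -(p + 1) by ring]
  ring

lemma hasDerivAt_powEven (p t : ℝ) (ht : 0 ≤ t) (ht1 : t < 1) :
    HasDerivAt (powEven p) (p * powOdd (p + 1) t) t := by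
  refine ((hasDerivAt_one_add_rpow p t ht).add (hasDerivAt_one_sub_rpow p t ht1)).congr_deriv ?_
  rw [powOdd]
  ring

lemma hasDerivAt_powOdd (p t : ℝ) (ht : 0 ≤ t) (ht1 : t < 1) :
    HasDerivAt (powOdd p) (p * powEven (p + 1) t) t := by
  refine ((hasDerivAt_one_sub_rpow p t ht1).sub (hasDerivAt_one_add_rpow p t ht)).congr_deriv ?_
  rw [powEven]
  ring

lemma powOdd_nonneg {p t : ℝ} (hp : 0 ≤ p) (ht : 0 ≤ t) (ht1 : t < 1) : 0 ≤ powOdd p t :=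
  sub_nonneg.2 (Real.rpow_le_rpow_of_nonpos (by linarith) (by linarith) (by linarith))

lemma two_le_powEven {p t : ℝ} (hp : 0 ≤ p) (ht : 0 ≤ t) (ht1 : t < 1) : 2 ≤ powEven p t :=
  le_of_hasDerivAt_le (A := fun _ => 2) (A' := fun _ => 0) (b := 1)
    (fun t _ _ => hasDerivAt_const _ _) (hasDerivAt_powEven p)
    (by simp [powEven]; norm_num)
    (fun _ h h1 => mul_nonneg hp (powOdd_nonneg (by linarith) h h1)) t ht ht1

lemma le_powOdd {p t : ℝ} (hp : 0 ≤ p) (ht : 0 ≤ t) (ht1 : t < 1) : 2 * p * t ≤ powOdd p t :=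
  le_of_hasDerivAt_le (A := fun t => 2 * p * t) (A' := fun _ => 2 * p) (b := 1)
    (fun t _ _ => by simpa using (hasDerivAt_id' t).const_mul (2 * p)) (hasDerivAt_powOdd p)
    (by simp [powOdd])
    (fun _ h h1 => by nlinarith [two_le_powEven (p := p + 1) (by linarith) h h1]) t ht ht1

lemma le_powEven_of_nonneg {p t : ℝ} (hp : 0 ≤ p) (ht : 0 ≤ t) (ht1 : t < 1) :
    2 + p * (p + 1) * t ^ 2 ≤ powEven p t :=
  le_of_hasDerivAt_le (A := fun t => 2 + p * (p + 1) * t ^ 2)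
    (A' := fun t => p * (p + 1) * (2 * t)) (b := 1)
    (fun t _ _ => by simpa using ((hasDerivAt_pow 2 t).const_mul (p * (p + 1))).const_add 2)
    (hasDerivAt_powEven p)
    (by simp [powEven]; norm_num)
    (fun _ h h1 => by
      have := mul_le_mul_of_nonneg_left (le_powOdd (p := p + 1) (by linarith) h h1) hp
      linarith) t ht ht1

lemma le_powEven {p t : ℝ} (hp : 0 ≤ p) (ht : |t| < 1) :
    2 + p * (p + 1) * t ^ 2 ≤ powEven p t := by
  rw [← powEven_abs, ← sq_abs]
  exact le_powEven_of_nonneg hp (abs_nonneg t) ht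

lemma one_sub_rpow_le {p t : ℝ} (hp : 0 ≤ p) (ht1 : t < 1 / 2) :
    (1 - t) ^ (-p) ≤ 2 ^ p := by
  have : (1 - t) ^ (-p) ≤ (1 / 2 : ℝ) ^ (-p) :=
    Real.rpow_le_rpow_of_nonpos (by norm_num) (by linarith) (by linarith)
  simpa [Real.rpow_neg, Real.inv_rpow] using this

lemma powEven_le_const {p t : ℝ} (hp : 0 ≤ p) (ht : 0 ≤ t) (ht1 : t < 1 / 2) :
    powEven p t ≤ 2 * 2 ^ p := by
  have h1 := one_sub_rpow_le hp ht1
  have h2 : (1 + t) ^ (-p) ≤ 1 := Real.rpow_le_one_of_one_le_of_nonpos (by linarith) (by linarith)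
  have h3 : (1 : ℝ) ≤ 2 ^ p := Real.one_le_rpow (by norm_num) hp
  unfold powEven
  linarith

/-- `powEven` and `powOdd` differentiate into each other with the exponent raised by one, so four
integrations of a crude bound at exponent `p + 4` give the expansion. The sharp coefficient of `t ^
2` is what later makes leading terms cancel. -/
lemma exists_powEven_le {p : ℝ} (hp : 0 ≤ p) : ∃ C : ℝ, 0 ≤ C ∧ ∀ t : ℝ, |t| < 1 / 2 →
    powEven p t ≤ 2 + p * (p + 1) * t ^ 2 + C * t ^ 4 := by
  have e0 : ∀ q : ℝ, powEven q 0 = 2 := fun q => by simp [powEven]; norm_num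
  have o0 : ∀ q : ℝ, powOdd q 0 = 0 := fun q => by simp [powOdd]
  have hodd : ∀ {q a b : ℝ}, 0 ≤ q → (∀ t, 0 ≤ t → t < 1 / 2 → powEven (q + 1) t ≤ a + b * t ^ 2) →
      ∀ t, 0 ≤ t → t < 1 / 2 → powOdd q t ≤ q * a * t + q * b / 3 * t ^ 3 := by
    intro q a b hq h
    refine le_of_hasDerivAt_le (A' := fun t => q * powEven (q + 1) t)
      (B' := fun t => q * (a + b * t ^ 2))
      (fun t h0 h1 => hasDerivAt_powOdd q t h0 (by linarith)) (fun t _ _ => ?_) (by simp [o0])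
      (fun t h0 h1 => mul_le_mul_of_nonneg_left (h t h0 h1) hq)
    have := ((hasDerivAt_id' t).const_mul (q * a)).add ((hasDerivAt_pow 3 t).const_mul (q * b / 3))
    refine this.congr_deriv ?_
    norm_num
    ring
  have heven : ∀ {q a b : ℝ}, 0 ≤ q →
      (∀ t, 0 ≤ t → t < 1 / 2 → powOdd (q + 1) t ≤ a * t + b * t ^ 3) →
      ∀ t, 0 ≤ t → t < 1 / 2 → powEven q t ≤ 2 + q * a / 2 * t ^ 2 + q * b / 4 * t ^ 4 := by
    intro q a b hq h
    refine le_of_hasDerivAt_le (A' := fun t => q * powOdd (q + 1) t)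
      (B' := fun t => q * (a * t + b * t ^ 3))
      (fun t h0 h1 => hasDerivAt_powEven q t h0 (by linarith)) (fun t _ _ => ?_) (by simp [e0])
      (fun t h0 h1 => mul_le_mul_of_nonneg_left (h t h0 h1) hq)
    have := (((hasDerivAt_pow 2 t).const_mul (q * a / 2)).const_add 2).add
      ((hasDerivAt_pow 4 t).const_mul (q * b / 4))
    refine this.congr_deriv ?_
    norm_num
    ring
  obtain ⟨b₀, hb₀⟩ : ∃ b₀ : ℝ, b₀ = 2 * 2 ^ (p + 4) := ⟨_, rfl⟩
  have s1 := hodd (q := p + 3) (a := b₀) (b := 0) (by linarith) (fun t h0 h1 => by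
    have := powEven_le_const (p := p + 3 + 1) (by linarith) h0 h1
    rw [show p + 3 + 1 = p + 4 by ring] at this ⊢
    rw [hb₀]; linarith)
  have s2 := heven (q := p + 2) (a := (p + 3) * b₀) (b := (p + 3) * 0 / 3) (by linarith)
    (fun t h0 h1 => by
      have := s1 t h0 h1
      rwa [show p + 2 + 1 = p + 3 by ring])
  have s3 := hodd (q := p + 1) (a := 2) (b := (p + 2) * ((p + 3) * b₀) / 2) (by linarith)
    (fun t h0 h1 => by
      have := s2 t h0 h1
      rw [show p + 1 + 1 = p + 2 by ring]
      linarith)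
  have s4 := heven (q := p) (a := (p + 1) * 2)
    (b := (p + 1) * ((p + 2) * ((p + 3) * b₀) / 2) / 3) hp s3
  have hb : 0 ≤ b₀ := by rw [hb₀]; positivity
  refine ⟨p * ((p + 1) * ((p + 2) * ((p + 3) * b₀) / 2) / 3) / 4, by positivity, fun t ht => ?_⟩
  · rw [← powEven_abs, ← sq_abs, show t ^ 4 = |t| ^ 4 by rw [← abs_pow, abs_of_nonneg (by positivity)]]
    have := s4 |t| (abs_nonneg t) ht
    rw [show p * ((p + 1) * 2) / 2 = p * (p + 1) by ring] at this
    exact this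

lemma le_one_sub_rpow {p t : ℝ} (hp : 0 ≤ p) (ht : 0 ≤ t) (ht1 : t < 1) :
    1 + p * t ≤ (1 - t) ^ (-p) :=
  le_of_hasDerivAt_le (A := fun t => 1 + p * t) (A' := fun _ => p) (b := 1)
    (B := fun t => (1 - t) ^ (-p))
    (fun t _ _ => by simpa using ((hasDerivAt_id' t).const_mul p).const_add 1)
    (fun t _ h => hasDerivAt_one_sub_rpow p t h) (by simp)
    (fun t h h1 => le_mul_of_one_le_right hp
      (Real.one_le_rpow_of_pos_of_le_one_of_nonpos (by linarith) (by linarith) (by linarith)))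
    t ht ht1

lemma exists_one_sub_rpow_le {p : ℝ} (hp : 0 ≤ p) : ∃ C : ℝ, 0 ≤ C ∧ ∀ t : ℝ, 0 ≤ t → t < 1 / 2 →
    (1 - t) ^ (-p) ≤ 1 + p * t + C * t ^ 2 := by
  have key : ∀ {q a b : ℝ}, 0 ≤ q →
      (∀ t, 0 ≤ t → t < 1 / 2 → (1 - t) ^ (-(q + 1)) ≤ a + b * t) →
      ∀ t, 0 ≤ t → t < 1 / 2 → (1 - t) ^ (-q) ≤ 1 + q * a * t + q * b / 2 * t ^ 2 := by
    intro q a b hq h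
    refine le_of_hasDerivAt_le (A' := fun t => q * (1 - t) ^ (-(q + 1)))
      (B' := fun t => q * (a + b * t)) (A := fun t => (1 - t) ^ (-q))
      (fun t h0 h1 => hasDerivAt_one_sub_rpow q t (by linarith)) (fun t _ _ => ?_) (by simp)
      (fun t h0 h1 => mul_le_mul_of_nonneg_left (h t h0 h1) hq)
    have := (((hasDerivAt_id' t).const_mul (q * a)).const_add 1).add
      ((hasDerivAt_pow 2 t).const_mul (q * b / 2))
    refine this.congr_deriv ?_
    norm_num
    ring
  have s1 := key (q := p + 1) (a := 2 ^ (p + 2)) (b := 0) (by linarith) (fun t h0 h1 => by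
    have := one_sub_rpow_le (p := p + 1 + 1) (by linarith) h1
    rw [show p + 1 + 1 = p + 2 by ring] at this ⊢
    linarith)
  have s2 := key (q := p) (a := 1) (b := (p + 1) * 2 ^ (p + 2)) hp (fun t h0 h1 => by
    have := s1 t h0 h1
    linarith)
  refine ⟨p * ((p + 1) * 2 ^ (p + 2)) / 2, by positivity, fun t h0 h1 => ?_⟩
  have := s2 t h0 h1
  linarith

/-! ### The minimum principle -/

/-- A negative value forces a minimum, attained at finitely many points. At the minimizer with
largest coordinate `i`, the neighbour in direction `e_i` is strictly larger, so the average exceeds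
the minimum. Since superharmonicity is asked only at negative points, it need not be known where
nonnegativity is clear beforehand. -/
lemma min_principle [NeZero d] {w : Lat d → ℝ} (h0 : Tendsto w cofinite (𝓝 0))
    (h : ∀ x, w x < 0 → nbrAvg w x ≤ w x) (x : Lat d) : 0 ≤ w x := by
  by_contra! hx
  have hd : 0 < (d : ℝ) := Nat.cast_pos.2 (NeZero.pos d)
  have hfin : {y | w y ≤ w x}.Finite := by
    have : ∀ᶠ y in cofinite, w x < w y := h0.eventually (lt_mem_nhds hx)
    simpa [eventually_cofinite] using this
  obtain ⟨m, hm, hmin⟩ := Set.exists_min_image _ w hfin ⟨x, le_refl (w x)⟩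
  have hmin' : ∀ y, w m ≤ w y := fun y => by
    by_cases hy : w y ≤ w x
    · exact hmin y hy
    · exact hm.trans (not_le.1 hy).le
  have hfin' : {y | w y = w m}.Finite := hfin.subset fun y hy => by
    rw [Set.mem_ofPred_eq] at hy ⊢
    exact hy.trans_le hm
  let i : Fin d := ⟨0, NeZero.pos d⟩
  obtain ⟨z, hz, hmax⟩ := Set.exists_max_image _ (fun y : Lat d => y i) hfin' ⟨m, rfl⟩
  rw [Set.mem_ofPred_eq] at hz
  have hz0 : w z < 0 := by rw [hz]; exact lt_of_le_of_lt hm hx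
  have hne : w (z + unitStep (i, true)) ≠ w m := fun he => by
    have := hmax _ he
    simp [unitStep] at this
  have hlt : w z < nbrAvg w z := by
    calc w z = nbrAvg (fun _ => w m) z := by rw [nbrAvg_const, hz]
      _ < nbrAvg w z := by
          unfold nbrAvg
          refine div_lt_div_of_pos_right ?_ (by positivity)
          exact Finset.sum_lt_sum (fun s _ => hmin' _)
            ⟨(i, true), Finset.mem_univ _, lt_of_le_of_ne (hmin' _) hne.symm⟩
  exact absurd (h z hz0) (not_le.2 hlt)

lemma eq_zero_of_harmonic [NeZero d] {w : Lat d → ℝ} (h0 : Tendsto w cofinite (𝓝 0))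
    (h : ∀ x, w x ≠ 0 → nbrAvg w x = w x) (x : Lat d) : w x = 0 := by
  refine le_antisymm ?_ (min_principle h0 (fun x hx => (h x hx.ne).le) x)
  have h0' : Tendsto (fun x => (-1) * w x) cofinite (𝓝 0) := by simpa using h0.const_mul (-1)
  have := min_principle h0' (fun x hx => by
    rw [nbrAvg_const_mul, h x (by rintro h; simp [h] at hx)]) x
  linarith

/-- A function that is superharmonic on the half space `{x | 0 ≤ x j}` and antisymmetric across
its boundary is nonnegative there if it vanishes at infinity. -/
lemma min_principle_halfSpace [NeZero d] {w : Lat d → ℝ} (j : Fin d)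
    (h0 : Tendsto w cofinite (𝓝 0)) (h : ∀ x : Lat d, 0 ≤ x j → nbrAvg w x ≤ w x)
    (hanti : ∀ x : Lat d, x j = 0 → w (x + unitStep (j, false)) = - w x)
    (x : Lat d) (hx : 0 ≤ x j) : 0 ≤ w x := by
  -- Truncating to zero off the half space reduces to `min_principle`: across the boundary the
  -- truncated value 0 lies below `w`, which by antisymmetry is the positive number `-w x` there.
  let v : Lat d → ℝ := fun x => if 0 ≤ x j then w x else 0
  have hv0 : Tendsto v cofinite (𝓝 0) := by
    rw [tendsto_zero_iff_abs_tendsto_zero] at h0 ⊢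
    refine squeeze_zero (fun _ => abs_nonneg _) (fun x => ?_) h0
    simp only [Function.comp, v]
    split_ifs <;> simp
  have := min_principle hv0 (fun x hx => ?_) x
  · simpa [v, hx] using this
  · have hxj : 0 ≤ x j := by
      by_contra hn
      simp [v, hn] at hx
    have hvx : v x = w x := by simp [v, hxj]
    rw [hvx] at hx ⊢
    refine le_trans (nbrAvg_mono fun s => ?_) (h x hxj)
    simp only [v]
    split_ifs with hs
    · exact le_rfl
    · obtain ⟨i, b⟩ := s
      by_cases hij : i = j
      · subst hij
        cases b
        · have hx0 : x i = 0 := by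
            simp [unitStep] at hs
            omega
          rw [hanti x hx0]
          linarith
        · simp [unitStep] at hs
          omega
      · refine absurd ?_ hs
        simpa [unitStep, Pi.single_apply, Ne.symm hij] using hxj

/-! ### Powers of the Euclidean norm -/

/-- The square of the Euclidean norm of `x + c`. -/
def sqDist (c : Fin d → ℝ) (x : Lat d) : ℝ := ∑ i, ((x i : ℝ) + c i) ^ 2

lemma sqDist_nonneg (c : Fin d → ℝ) (x : Lat d) : 0 ≤ sqDist c x :=
  Finset.sum_nonneg fun _ _ => sq_nonneg _

lemma sq_le_sqDist (c : Fin d → ℝ) (x : Lat d) (i : Fin d) : ((x i : ℝ) + c i) ^ 2 ≤ sqDist c x :=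
  Finset.single_le_sum (f := fun i => ((x i : ℝ) + c i) ^ 2) (fun _ _ => sq_nonneg _)
    (Finset.mem_univ i)

lemma sqDist_add_unitStep (c : Fin d → ℝ) (x : Lat d) (i : Fin d) (b : Bool) :
    sqDist c (x + unitStep (i, b)) =
      sqDist c x + 1 + (if b then 1 else -1) * (2 * ((x i : ℝ) + c i)) := by
  have h : ∀ k, ((((x + unitStep (i, b)) k : ℤ) : ℝ) + c k) ^ 2 = ((x k : ℝ) + c k) ^ 2 +
      if k = i then 1 + (if b then 1 else -1) * (2 * ((x k : ℝ) + c k)) else 0 := by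
    intro k
    by_cases hk : k = i
    · subst hk
      cases b <;> simp [unitStep] <;> ring_nf
    · simp [unitStep, hk]
  unfold sqDist
  simp only [h, Finset.sum_add_distrib, Finset.sum_ite_eq', Finset.mem_univ, if_true, add_assoc]

lemma norm_sq_le_sqDist (x : Lat d) : ‖x‖ ^ 2 ≤ sqDist 0 x := by
  have h : ‖x‖ ≤ √(sqDist 0 x) := by
    refine (pi_norm_le_iff_of_nonneg (Real.sqrt_nonneg _)).2 fun i => Real.le_sqrt_of_sq_le ?_
    rw [Int.norm_eq_abs, sq_abs]
    simpa using sq_le_sqDist 0 x i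
  calc ‖x‖ ^ 2 ≤ √(sqDist 0 x) ^ 2 := by gcongr
    _ = _ := Real.sq_sqrt (sqDist_nonneg _ _)

lemma sqDist_le_norm_sq (x : Lat d) : sqDist 0 x ≤ d * ‖x‖ ^ 2 := by
  calc sqDist 0 x ≤ ∑ _i : Fin d, ‖x‖ ^ 2 := Finset.sum_le_sum fun i _ => by
        have : |(x i : ℝ)| ≤ ‖x‖ := by
          rw [← Int.norm_eq_abs]; exact norm_le_pi_norm x i
        simpa using pow_le_pow_left₀ (abs_nonneg _) this 2
    _ = d * ‖x‖ ^ 2 := by simp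

/-- The ratio `2 (x i + c i) / (|x + c|² + a + 1)`. -/
def stepRatio (c : Fin d → ℝ) (a : ℝ) (x : Lat d) (i : Fin d) : ℝ :=
  2 * ((x i : ℝ) + c i) / (sqDist c x + a + 1)

lemma sum_stepRatio_sq (c : Fin d → ℝ) (a : ℝ) (x : Lat d) :
    ∑ i, stepRatio c a x i ^ 2 = 4 * sqDist c x / (sqDist c x + a + 1) ^ 2 := by
  simp only [stepRatio, div_pow, mul_pow, ← Finset.sum_div, ← Finset.mul_sum]
  norm_num [sqDist]

lemma stepRatio_sq_le (c : Fin d → ℝ) (a : ℝ) (x : Lat d) (i : Fin d) :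
    stepRatio c a x i ^ 2 ≤ 4 * sqDist c x / (sqDist c x + a + 1) ^ 2 := by
  rw [← sum_stepRatio_sq]
  exact Finset.single_le_sum (f := fun i => stepRatio c a x i ^ 2) (fun _ _ => sq_nonneg _)
    (Finset.mem_univ i)

/-- A step in direction ±e_i changes |x + c|² + a into σ(1 ± t), with σ = |x + c|² + a + 1 and t the
`stepRatio`. This turns the discrete Laplacian of a power into a sum of one-variable functions. -/
lemma rpow_sqDist_add_unitStep {c : Fin d → ℝ} {a p : ℝ} {x : Lat d} {i : Fin d}
    (hσ : 0 < sqDist c x + a + 1) (ht : |stepRatio c a x i| ≤ 1) (b : Bool) :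
    (sqDist c (x + unitStep (i, b)) + a) ^ (-p) = (sqDist c x + a + 1) ^ (-p) *
      (1 + (if b then 1 else -1) * stepRatio c a x i) ^ (-p) := by
  rw [← Real.mul_rpow hσ.le, sqDist_add_unitStep]
  · congr 1
    unfold stepRatio
    field_simp
    ring
  · rw [abs_le] at ht
    cases b <;> simp <;> linarith

lemma nbrAvg_rpow_sqDist {c : Fin d → ℝ} {a p : ℝ} {x : Lat d}
    (hσ : 0 < sqDist c x + a + 1) (ht : ∀ i, |stepRatio c a x i| ≤ 1) :
    nbrAvg (fun x => (sqDist c x + a) ^ (-p)) x =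
      (sqDist c x + a + 1) ^ (-p) * ((∑ i, powEven p (stepRatio c a x i)) / (2 * d)) := by
  unfold nbrAvg
  rw [Fintype.sum_prod_type]
  simp only [Fintype.sum_bool]
  simp_rw [rpow_sqDist_add_unitStep hσ (ht _), ← mul_add]
  rw [← Finset.mul_sum, mul_div_assoc]
  simp [powEven, sub_eq_add_neg]

lemma rpow_sqDist_eq {c : Fin d → ℝ} {a p : ℝ} {x : Lat d} (hσ : 1 ≤ sqDist c x + a + 1) :
    (sqDist c x + a) ^ (-p) =
      (sqDist c x + a + 1) ^ (-p) * (1 - 1 / (sqDist c x + a + 1)) ^ (-p) := by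
  rw [← Real.mul_rpow (by linarith)]
  · congr 1
    field_simp
    ring
  · rw [sub_nonneg, div_le_one (by linarith)]
    exact hσ

/-- Since t_i² ≤ 4/σ, taking `a ≥ 16` puts every ratio in the range of the expansion. The quadratic
terms add up exactly by `sum_stepRatio_sq`, and the quartic ones contribute at most 8C/σ² after
division by 2d. -/
lemma sum_powEven_stepRatio_le [NeZero d] {c : Fin d → ℝ} {a p C : ℝ} (ha : 16 ≤ a) (hC : 0 ≤ C)
    (h : ∀ t : ℝ, |t| < 1 / 2 → powEven p t ≤ 2 + p * (p + 1) * t ^ 2 + C * t ^ 4) (x : Lat d) :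
    (∀ i, |stepRatio c a x i| < 1 / 2) ∧
    (∑ i, powEven p (stepRatio c a x i)) / (2 * d) ≤
      1 + (2 * p * (p + 1) / d * sqDist c x + 8 * C) / (sqDist c x + a + 1) ^ 2 := by
  have hd : 0 < (d : ℝ) := Nat.cast_pos.2 (NeZero.pos d)
  have hQ := sqDist_nonneg c x
  set σ := sqDist c x + a + 1 with hσ
  have hσ16 : 16 < σ := by linarith
  have ht2 : ∀ i, stepRatio c a x i ^ 2 ≤ 4 / σ := fun i => by
    refine (stepRatio_sq_le c a x i).trans ?_
    rw [← hσ, div_le_div_iff₀ (by positivity) (by positivity)]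
    nlinarith
  have ht : ∀ i, |stepRatio c a x i| < 1 / 2 := fun i => by
    refine abs_lt_of_sq_lt_sq ?_ (by norm_num)
    refine (ht2 i).trans_lt ?_
    rw [div_lt_iff₀ (by positivity)]
    linarith
  refine ⟨ht, ?_⟩
  have hsum : ∑ i, powEven p (stepRatio c a x i) ≤
      2 * d + p * (p + 1) * (4 * sqDist c x / σ ^ 2) + d * (C * (16 / σ ^ 2)) := by
    calc _ ≤ ∑ i, (2 + p * (p + 1) * stepRatio c a x i ^ 2 + C * (16 / σ ^ 2)) := by
          refine Finset.sum_le_sum fun i _ => (h _ (ht i)).trans ?_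
          have h4 : stepRatio c a x i ^ 4 ≤ 16 / σ ^ 2 := by
            calc stepRatio c a x i ^ 4 = (stepRatio c a x i ^ 2) ^ 2 := by ring
              _ ≤ (4 / σ) ^ 2 := pow_le_pow_left₀ (sq_nonneg _) (ht2 i) 2
              _ = 16 / σ ^ 2 := by rw [div_pow]; norm_num
          have := mul_le_mul_of_nonneg_left h4 hC
          linarith
      _ = _ := by
          rw [Finset.sum_add_distrib, Finset.sum_add_distrib, ← Finset.mul_sum, sum_stepRatio_sq,
            ← hσ]
          simp [mul_comm]
  rw [div_le_iff₀ (by positivity)]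
  refine hsum.trans (le_of_eq ?_)
  field_simp
  ring

lemma tendsto_norm_cofinite : Tendsto (fun x : Lat d => ‖x‖) cofinite atTop := by
  rw [← cocompact_eq_cofinite]
  exact tendsto_norm_cocompact_atTop

lemma tendsto_sqDist_cofinite {c : Fin d → ℝ} (hc : ∀ x, sqDist 0 x / 4 ≤ sqDist c x) :
    Tendsto (fun x : Lat d => sqDist c x) cofinite atTop := by
  refine tendsto_atTop_mono (fun x => ?_)
    (((tendsto_pow_atTop two_ne_zero).comp tendsto_norm_cofinite).atTop_div_const
      (r := 4) (by norm_num))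
  refine le_trans ?_ (hc x)
  have := norm_sq_le_sqDist x
  simp only [Function.comp]
  linarith

lemma tendsto_rpow_sqDist_cofinite {c : Fin d → ℝ} (hc : ∀ x, sqDist 0 x / 4 ≤ sqDist c x) (a : ℝ)
    {p : ℝ} (hp : 0 < p) :
    Tendsto (fun x : Lat d => (sqDist c x + a) ^ (-p)) cofinite (𝓝 0) :=
  (tendsto_rpow_neg_atTop hp).comp (tendsto_atTop_add_const_right _ a (tendsto_sqDist_cofinite hc))

lemma sqDist_zero_div_le (x : Lat d) : sqDist 0 x / 4 ≤ sqDist 0 x := by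
  linarith [sqDist_nonneg 0 x]

/-! ### The Green function: transience and upper bound -/

/-- The exponent p = (d-2)/2 satisfies 2p(p+1)/d = p, so the terms of order 1/σ on both sides agree.
The shift decides the sign of the rest: p ≥ 1/2 and a = 16 + 16C give p(a+1) > 8C. -/
lemma exists_supersolution [NeZero d] (hd : 3 ≤ d) : ∃ a : ℝ, 16 ≤ a ∧ ∀ x : Lat d,
    nbrAvg (fun x => (sqDist 0 x + a) ^ (-(((d : ℝ) - 2) / 2))) x <
      (sqDist 0 x + a) ^ (-(((d : ℝ) - 2) / 2)) := by
  have hd' : (3 : ℝ) ≤ d := by exact_mod_cast hd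
  set p : ℝ := ((d : ℝ) - 2) / 2 with hp
  have hp0 : 1 / 2 ≤ p := by rw [hp]; linarith
  obtain ⟨C, hC, h⟩ := exists_powEven_le (p := p) (by linarith)
  refine ⟨16 + 16 * C, by linarith, fun x => ?_⟩
  set a := 16 + 16 * C with ha
  have hQ := sqDist_nonneg 0 x
  obtain ⟨ht, hs⟩ := sum_powEven_stepRatio_le (c := 0) (a := a) (p := p) (by linarith) hC h x
  have hσ : 0 < sqDist 0 x + a + 1 := by linarith
  rw [nbrAvg_rpow_sqDist hσ fun i => (ht i).le.trans (by norm_num),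
    rpow_sqDist_eq (by linarith)]
  refine mul_lt_mul_of_pos_left ?_ (Real.rpow_pos_of_pos hσ _)
  have h1 := le_one_sub_rpow (p := p) (t := 1 / (sqDist 0 x + a + 1)) (by linarith) (by positivity)
    (by rw [div_lt_one hσ]; linarith)
  refine hs.trans_lt (lt_of_lt_of_le ?_ h1)
  have h2 : 2 * p * (p + 1) / d = p := by
    rw [hp]; field_simp; ring
  rw [h2, mul_one_div, add_lt_add_iff_left, div_lt_div_iff₀ (by positivity) hσ]
  have : p * sqDist 0 x + 8 * C < p * (sqDist 0 x + a + 1) := by nlinarith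
  nlinarith

lemma transProb_add_right [NeZero d] (n : ℕ) (x y a : Lat d) :
    transProb n (x + a) (y + a) = transProb n x y :=
  transProb_map (· + a) (add_left_injective a) (Equiv.refl _)
    (fun x s => by simp only [Equiv.refl_apply]; abel) n x y

/-- The partial Green sums satisfy G_{n+1} = 1_{0} + avg G_n. The factor M makes the superharmonic
defect of M·u at the origin equal to 1, so the bound by M·u propagates by induction. It yields both
transience and the decay of g. -/
lemma exists_sum_transProb_le [NeZero d] (hd : 3 ≤ d) : ∃ a M : ℝ, 16 ≤ a ∧ 0 ≤ M ∧
    ∀ (n : ℕ) (x : Lat d), ∑ k ∈ Finset.range n, transProb k x 0 ≤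
      M * (sqDist 0 x + a) ^ (-(((d : ℝ) - 2) / 2)) := by
  obtain ⟨a, ha, h⟩ := exists_supersolution hd
  set u : Lat d → ℝ := fun x => (sqDist 0 x + a) ^ (-(((d : ℝ) - 2) / 2)) with hu
  have hu0 : ∀ x, 0 ≤ u x := fun x => Real.rpow_nonneg (by linarith [sqDist_nonneg 0 x]) _
  have hpos : 0 < u 0 - nbrAvg u 0 := sub_pos.2 (h 0)
  refine ⟨a, (u 0 - nbrAvg u 0)⁻¹, ha, (inv_pos.2 hpos).le, fun n => ?_⟩
  set M := (u 0 - nbrAvg u 0)⁻¹ with hM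
  have hM0 : 0 ≤ M := (inv_pos.2 hpos).le
  induction n with
  | zero => intro x; simpa using mul_nonneg hM0 (hu0 x)
  | succ n ih =>
    intro x
    rw [Finset.sum_range_succ']
    simp only [transProb_succ, transProb_zero]
    rw [← nbrAvg_sum]
    have h1 : nbrAvg (fun y => ∑ k ∈ Finset.range n, transProb k y 0) x ≤ M * nbrAvg u x := by
      rw [← nbrAvg_const_mul]
      exact nbrAvg_mono fun s => ih _
    have h2 : M * nbrAvg u x + (if x = 0 then 1 else 0) ≤ M * u x := by
      split_ifs with hx
      · subst hx
        have : M * (u 0 - nbrAvg u 0) = 1 := inv_mul_cancel₀ hpos.ne'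
        linarith
      · have := mul_le_mul_of_nonneg_left (h x).le hM0
        linarith
    linarith

lemma summable_transProb [NeZero d] (hd : 3 ≤ d) (x y : Lat d) :
    Summable fun n => transProb n x y := by
  obtain ⟨a, M, -, -, h⟩ := exists_sum_transProb_le hd
  have hs : Summable fun n => transProb n (x - y) 0 :=
    summable_of_sum_range_le (fun n => transProb_nonneg _ _ _) fun n => h n _
  refine hs.congr fun n => ?_
  rw [← transProb_add_right n (x - y) 0 y]
  simp

lemma green_nonneg [NeZero d] (x y : Lat d) : 0 ≤ green x y :=
  tsum_nonneg fun _ => measureReal_nonneg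

lemma green_eq_add_nbrAvg [NeZero d] (hd : 3 ≤ d) (x y : Lat d) :
    green x y = (if x = y then 1 else 0) + nbrAvg (fun u => green u y) x := by
  have hs := summable_transProb hd
  change ∑' n, transProb n x y = _
  rw [(hs x y).tsum_eq_zero_add, transProb_zero]
  congr 1
  simp only [transProb_succ, nbrAvg]
  rw [tsum_div_const, Summable.tsum_finsetSum fun s _ => hs _ _]
  rfl

lemma exists_green_le_rpow [NeZero d] (hd : 3 ≤ d) : ∃ a M : ℝ, 16 ≤ a ∧ 0 ≤ M ∧
    ∀ x : Lat d, green x 0 ≤ M * (sqDist 0 x + a) ^ (-(((d : ℝ) - 2) / 2)) := by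
  obtain ⟨a, M, ha, hM, h⟩ := exists_sum_transProb_le hd
  exact ⟨a, M, ha, hM, fun x =>
    (summable_transProb hd x 0).tsum_le_of_sum_range_le fun n => h n x⟩

lemma tendsto_green_cofinite [NeZero d] (hd : 3 ≤ d) (y : Lat d) :
    Tendsto (fun x => green x y) cofinite (𝓝 0) := by
  obtain ⟨a, M, ha, hM, h⟩ := exists_green_le_rpow hd
  have hd' : (3 : ℝ) ≤ d := by exact_mod_cast hd
  have h0 : Tendsto (fun x : Lat d => green x 0) cofinite (𝓝 0) := by
    refine squeeze_zero (fun x => green_nonneg _ _) h ?_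
    simpa using (tendsto_rpow_sqDist_cofinite sqDist_zero_div_le a
      (p := ((d : ℝ) - 2) / 2) (by linarith)).const_mul M
  have : Tendsto (fun x : Lat d => x - y) cofinite cofinite :=
    (sub_left_injective (b := y)).tendsto_cofinite
  refine (h0.comp this).congr fun x => ?_
  simp only [Function.comp]
  rw [green_eq_sub x y]

lemma rpow_sq_neg_half {r : ℝ} (hr : 0 ≤ r) (m : ℕ) :
    (r ^ 2) ^ (-((m : ℝ) / 2)) = (r ^ m)⁻¹ := by
  rw [Real.rpow_neg (by positivity), ← Real.rpow_natCast r 2, ← Real.rpow_mul hr,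
    ← Real.rpow_natCast r m]
  congr 2
  push_cast
  ring

lemma exists_green_le [NeZero d] (hd : 3 ≤ d) : ∃ C : ℝ, 0 < C ∧
    ∀ x y : Lat d, x ≠ y → green x y ≤ C / ‖x - y‖ ^ (d - 2) := by
  obtain ⟨a, M, ha, hM, h⟩ := exists_green_le_rpow hd
  refine ⟨M + 1, by linarith, fun x y hxy => ?_⟩
  have hn : 0 < ‖x - y‖ := norm_pos_iff.2 (sub_ne_zero.2 hxy)
  rw [green_eq_sub x y]
  have hcast : ((d : ℝ) - 2) / 2 = ((d - 2 : ℕ) : ℝ) / 2 := by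
    rw [Nat.cast_sub (by omega)]; norm_num
  calc green (x - y) 0 ≤ M * (sqDist 0 (x - y) + a) ^ (-(((d : ℝ) - 2) / 2)) := h _
    _ ≤ M * (‖x - y‖ ^ 2) ^ (-(((d : ℝ) - 2) / 2)) := by
        refine mul_le_mul_of_nonneg_left ?_ hM
        refine Real.rpow_le_rpow_of_nonpos (by positivity) ?_ ?_
        · linarith [norm_sq_le_sqDist (x - y)]
        · rw [hcast]; have : (0:ℝ) ≤ ((d - 2 : ℕ) : ℝ) := Nat.cast_nonneg _; linarith
    _ = M / ‖x - y‖ ^ (d - 2) := by rw [hcast, rpow_sq_neg_half hn.le, div_eq_mul_inv]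
    _ ≤ (M + 1) / ‖x - y‖ ^ (d - 2) := by gcongr; linarith

/-! ### Nearest neighbour paths -/

/-- The `ℓ¹`-distance of two sites. -/
def stepDist (x y : Lat d) : ℕ := ∑ i, (x i - y i).natAbs

lemma exists_step_toward {x y : Lat d} (h : x ≠ y) : ∃ s : Fin d × Bool,
    x + unitStep s ∈ Set.uIcc x y ∧ stepDist (x + unitStep s) y + 1 = stepDist x y := by
  obtain ⟨i, hi⟩ := Function.ne_iff.1 h
  have hdist : ∀ b : Bool, ((x + unitStep (i, b)) i - y i).natAbs + 1 = (x i - y i).natAbs →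
      stepDist (x + unitStep (i, b)) y + 1 = stepDist x y := by
    intro b hb
    unfold stepDist
    rw [← Finset.add_sum_erase _ _ (Finset.mem_univ i),
      ← Finset.add_sum_erase (a := i) _ _ (Finset.mem_univ i), ← hb]
    have : ∑ k ∈ Finset.univ.erase i, ((x + unitStep (i, b)) k - y k).natAbs =
        ∑ k ∈ Finset.univ.erase i, (x k - y k).natAbs :=
      Finset.sum_congr rfl fun k hk => by
        simp [unitStep, Finset.ne_of_mem_erase hk]
    rw [this]
    omega
  have hmem : ∀ b : Bool, (x + unitStep (i, b)) i ∈ Set.uIcc (x i) (y i) →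
      x + unitStep (i, b) ∈ Set.uIcc x y := by
    intro b hb
    rw [← Set.pi_univ_uIcc]
    intro k _
    by_cases hk : k = i
    · subst hk; exact hb
    · have : (x + unitStep (i, b)) k = x k := by simp [unitStep, hk]
      rw [this]
      exact Set.left_mem_uIcc
  rcases lt_or_gt_of_ne hi with hlt | hlt
  · refine ⟨(i, true), hmem _ ?_, hdist _ ?_⟩
    · rw [Set.mem_uIcc]; simp [unitStep]; omega
    · simp [unitStep]; omega
  · refine ⟨(i, false), hmem _ ?_, hdist _ ?_⟩
    · rw [Set.mem_uIcc]; simp [unitStep]; omega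
    · simp [unitStep]; omega

lemma stepDist_le (x y : Lat d) : (stepDist x y : ℝ) ≤ d * ‖x - y‖ := by
  unfold stepDist
  push_cast
  calc ∑ i, ((x i - y i).natAbs : ℝ) ≤ ∑ _i : Fin d, ‖x - y‖ := by
        refine Finset.sum_le_sum fun i _ => ?_
        have := norm_le_pi_norm (x - y) i
        rw [Int.norm_eq_abs] at this
        rw [Nat.cast_natAbs]
        simpa using this
    _ = d * ‖x - y‖ := by simp

/-- A lattice path that always moves closer to `y` stays in the box spanned by the endpoints, so the
gradient need be controlled only there. -/
lemma abs_sub_le_of_step_le {f : Lat d → ℝ} {M : ℝ} (x y : Lat d)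
    (h : ∀ u ∈ Set.uIcc x y, ∀ s, |f (u + unitStep s) - f u| ≤ M) :
    |f x - f y| ≤ stepDist x y * M := by
  induction hn : stepDist x y generalizing x with
  | zero =>
    have : x = y := by
      by_contra hne
      obtain ⟨s, -, hs⟩ := exists_step_toward hne
      omega
    simp [this]
  | succ n ih =>
    have hne : x ≠ y := by
      rintro rfl
      simp [stepDist] at hn
    obtain ⟨s, hmem, hs⟩ := exists_step_toward hne
    have hsub : Set.uIcc (x + unitStep s) y ⊆ Set.uIcc x y :=
      Set.uIcc_subset_uIcc hmem Set.right_mem_uIcc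
    have h1 := ih (x + unitStep s) (fun u hu => h u (hsub hu)) (by omega)
    have h2 := h x Set.left_mem_uIcc s
    rw [abs_sub_comm] at h2
    calc |f x - f y| ≤ |f x - f (x + unitStep s)| + |f (x + unitStep s) - f y| :=
          abs_sub_le _ _ _
      _ ≤ M + n * M := add_le_add h2 h1
      _ = (n + 1 : ℕ) * M := by push_cast; ring

/-! ### The Green function: lower bound -/

lemma green_pos [NeZero d] (hd : 3 ≤ d) (x y : Lat d) : 0 < green x y := by
  induction hn : stepDist x y generalizing x with
  | zero =>
    have : x = y := by
      by_contra hne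
      obtain ⟨s, -, hs⟩ := exists_step_toward hne
      omega
    subst this
    rw [green_eq_add_nbrAvg hd]
    have : 0 ≤ nbrAvg (fun u => green u x) x :=
      div_nonneg (Finset.sum_nonneg fun _ _ => green_nonneg _ _) (by positivity)
    simp
    linarith
  | succ n ih =>
    have hne : x ≠ y := by
      rintro rfl
      simp [stepDist] at hn
    obtain ⟨s, -, hs⟩ := exists_step_toward hne
    have hd' : 0 < (d : ℝ) := Nat.cast_pos.2 (NeZero.pos d)
    rw [green_eq_add_nbrAvg hd]
    simp only [hne, if_false, zero_add]
    refine div_pos ?_ (by positivity)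
    exact Finset.sum_pos' (fun _ _ => green_nonneg _ _)
      ⟨s, Finset.mem_univ _, ih _ (by omega)⟩

/-- The counterpart of the supersolution with the shift reversed. Now |x|² = σ + 2C, and the surplus
2pC/σ² in the average covers the Taylor error C/σ², because 2p ≥ 1. -/
lemma exists_subsolution [NeZero d] (hd : 3 ≤ d) : ∃ a R : ℝ, 0 ≤ a ∧ a < R ∧
    ∀ x : Lat d, R ≤ sqDist 0 x → (sqDist 0 x + -a) ^ (-(((d : ℝ) - 2) / 2)) ≤
      nbrAvg (fun x => (sqDist 0 x + -a) ^ (-(((d : ℝ) - 2) / 2))) x := by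
  have hd' : (3 : ℝ) ≤ d := by exact_mod_cast hd
  set p : ℝ := ((d : ℝ) - 2) / 2 with hp
  have hp0 : 1 / 2 ≤ p := by rw [hp]; linarith
  obtain ⟨C, hC, h⟩ := exists_one_sub_rpow_le (p := p) (by linarith)
  set a := 1 + 2 * C with ha
  refine ⟨a, 16 + 2 * a, by linarith, by linarith, fun x hx => ?_⟩
  set σ := sqDist 0 x + -a + 1 with hσd
  have hσ : 16 + a ≤ σ := by linarith
  have hσ0 : 0 < σ := by linarith
  have ht : ∀ i, |stepRatio 0 (-a) x i| < 1 := fun i => by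
    refine abs_lt_of_sq_lt_sq ?_ zero_le_one
    refine (stepRatio_sq_le 0 (-a) x i).trans_lt ?_
    rw [← hσd, div_lt_iff₀ (by positivity)]
    nlinarith
  rw [nbrAvg_rpow_sqDist hσ0 fun i => (ht i).le, rpow_sqDist_eq (by linarith), ← hσd]
  refine mul_le_mul_of_nonneg_left ?_ (Real.rpow_nonneg hσ0.le _)
  refine (h (1 / σ) (by positivity) ?_).trans ?_
  · rw [div_lt_div_iff₀ hσ0 (by norm_num)]; linarith
  have hsum : 2 * d + p * (p + 1) * (4 * sqDist 0 x / σ ^ 2) ≤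
      ∑ i, powEven p (stepRatio 0 (-a) x i) := by
    calc _ = ∑ i, (2 + p * (p + 1) * stepRatio 0 (-a) x i ^ 2) := by
          rw [Finset.sum_add_distrib, ← Finset.mul_sum, sum_stepRatio_sq, ← hσd]
          simp [mul_comm]
      _ ≤ _ := Finset.sum_le_sum fun i _ => le_powEven (by linarith) (ht i)
  rw [le_div_iff₀ (by positivity)]
  refine le_trans ?_ hsum
  have h2 : p + 1 = d / 2 := by rw [hp]; ring
  have h3 : sqDist 0 x = σ + 2 * C := by rw [hσd, ha]; ring
  rw [h2, h3]
  have h4 : p * (d / 2) * (4 * (σ + 2 * C) / σ ^ 2) = (p / σ + 2 * p * C / σ ^ 2) * (2 * d) := by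
    field_simp
    ring
  rw [h4]
  have h5 : C * (1 / σ) ^ 2 ≤ 2 * p * C / σ ^ 2 := by
    rw [one_div_pow, mul_one_div]
    gcongr
    nlinarith
  rw [mul_one_div]
  nlinarith

lemma exists_le_green [NeZero d] (hd : 3 ≤ d) : ∃ c : ℝ, 0 < c ∧
    ∀ x y : Lat d, c / (‖x - y‖ + 1) ^ (d - 2) ≤ green x y := by
  obtain ⟨a, R, ha, haR, h⟩ := exists_subsolution hd
  have hd' : (3 : ℝ) ≤ d := by exact_mod_cast hd
  have hcast : ((d : ℝ) - 2) / 2 = ((d - 2 : ℕ) : ℝ) / 2 := by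
    rw [Nat.cast_sub (by omega)]; norm_num
  set p : ℝ := ((d : ℝ) - 2) / 2 with hp
  have hp0 : 0 < p := by rw [hp]; linarith
  set v : Lat d → ℝ := fun x => (sqDist 0 x + -a) ^ (-p) with hv
  have hfin : {x : Lat d | sqDist 0 x < R}.Finite := by
    have := (tendsto_sqDist_cofinite (c := (0 : Fin d → ℝ)) sqDist_zero_div_le).eventually_ge_atTop R
    simpa [eventually_cofinite] using this
  -- The subsolution inequality is unavailable on the finite set `sqDist 0 x < R`. There `M`
  -- enforces the comparison directly; the bound by 1 settles the final estimate on the same set.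
  obtain ⟨M, hM1, hM⟩ : ∃ M : ℝ, 1 ≤ M ∧ ∀ x ∈ {x : Lat d | sqDist 0 x < R},
      1 ≤ M * green x 0 ∧ v x ≤ M * green x 0 := by
    obtain ⟨M, hM⟩ := (hfin.image fun x => (1 + |v x|) / green x 0).bddAbove
    refine ⟨max M 1, le_max_right _ _, fun x hx => ?_⟩
    have h1 := hM (Set.mem_image_of_mem _ hx)
    rw [div_le_iff₀ (green_pos hd x 0)] at h1
    have h2 : M * green x 0 ≤ max M 1 * green x 0 :=
      mul_le_mul_of_nonneg_right (le_max_left _ _) (green_nonneg _ _)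
    constructor <;> linarith [abs_nonneg (v x), le_abs_self (v x)]
  have hR0 : 0 < R := by linarith
  have hle : ∀ x, v x ≤ M * green x 0 := by
    intro x
    have hw0 : Tendsto (fun x => M * green x 0 - v x) cofinite (𝓝 0) := by
      simpa using ((tendsto_green_cofinite hd 0).const_mul M).sub
        (tendsto_rpow_sqDist_cofinite sqDist_zero_div_le (-a) hp0)
    have := min_principle hw0 (fun x hx => ?_) x
    · linarith
    · by_cases hxR : sqDist 0 x < R
      · have := (hM x hxR).2
        linarith
      · rw [nbrAvg_sub, nbrAvg_const_mul]
        have h1 := h x (not_lt.1 hxR)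
        have h2 := green_eq_add_nbrAvg hd x 0
        have h3 : (0 : ℝ) ≤ if x = 0 then 1 else 0 := by positivity
        have h4 : M * nbrAvg (fun u => green u 0) x ≤ M * green x 0 :=
          mul_le_mul_of_nonneg_left (by linarith) (by linarith)
        linarith
  set c : ℝ := min 1 ((d : ℝ) ^ (-p)) with hc
  have hcpos : 0 < c := lt_min one_pos (Real.rpow_pos_of_pos (by linarith) _)
  refine ⟨c / M, by positivity, fun x y => ?_⟩
  rw [green_eq_sub x y]
  generalize x - y = x
  have hn := norm_nonneg x
  have h1n : 1 ≤ (‖x‖ + 1) ^ (d - 2) := one_le_pow₀ (by linarith)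
  suffices hs : c / (‖x‖ + 1) ^ (d - 2) ≤ M * green x 0 by
    rw [div_div, mul_comm M, ← div_div, div_le_iff₀ (by linarith), mul_comm]
    exact hs
  by_cases hxR : sqDist 0 x < R
  · calc c / (‖x‖ + 1) ^ (d - 2) ≤ c := div_le_self hcpos.le h1n
      _ ≤ 1 := min_le_left _ _
      _ ≤ _ := (hM x hxR).1
  · rw [not_lt] at hxR
    have hx0 : 0 < ‖x‖ := by
      rw [norm_pos_iff]
      rintro rfl
      simp [sqDist] at hxR
      linarith
    calc c / (‖x‖ + 1) ^ (d - 2) ≤ (d : ℝ) ^ (-p) / ‖x‖ ^ (d - 2) := by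
          gcongr
          · exact min_le_right _ _
          · linarith
      _ = (d * ‖x‖ ^ 2) ^ (-p) := by
          rw [Real.mul_rpow (by positivity) (by positivity), hcast, rpow_sq_neg_half hn,
            div_eq_mul_inv]
      _ ≤ v x := Real.rpow_le_rpow_of_nonpos (by linarith)
          (by linarith [sqDist_le_norm_sq x]) (by linarith)
      _ ≤ _ := hle x

/-! ### The Green function: gradient bound -/

/-- Half of the `j`-th unit vector. -/
def halfVec (j : Fin d) : Fin d → ℝ := Pi.single j (1 / 2)

lemma sqDist_div_le_halfVec (j : Fin d) (x : Lat d) :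
    sqDist 0 x / 4 ≤ sqDist (halfVec j) x := by
  unfold sqDist
  rw [Finset.sum_div]
  refine Finset.sum_le_sum fun i _ => ?_
  by_cases hij : i = j
  · subst hij
    simp only [Pi.zero_apply, add_zero, halfVec, Pi.single_eq_same]
    rcases le_or_gt 0 (x i) with h | h
    · have : (0 : ℝ) ≤ x i := by exact_mod_cast h
      nlinarith
    · have : (x i : ℝ) ≤ -1 := by exact_mod_cast (by omega : x i ≤ -1)
      nlinarith
  · simp only [Pi.zero_apply, add_zero, halfVec, Pi.single_eq_of_ne hij]
    linarith [sq_nonneg (x i : ℝ)]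

/-- The dipole potential `(x j + 1/2) (|x + e_j / 2|² + a) ^ (-d/2)`. -/
def dipole (j : Fin d) (a : ℝ) (x : Lat d) : ℝ :=
  ((x j : ℝ) + 1 / 2) * (sqDist (halfVec j) x + a) ^ (-((d : ℝ) / 2))

lemma nbrAvg_dipole {j : Fin d} {a : ℝ} {x : Lat d} (ha : 0 ≤ a)
    (ht : ∀ i, |stepRatio (halfVec j) a x i| ≤ 1) :
    nbrAvg (dipole j a) x = (sqDist (halfVec j) x + a + 1) ^ (-((d : ℝ) / 2)) *
      (((x j : ℝ) + 1 / 2) *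
          ((∑ i, powEven ((d : ℝ) / 2) (stepRatio (halfVec j) a x i)) / (2 * d)) -
        powOdd ((d : ℝ) / 2) (stepRatio (halfVec j) a x j) / (2 * d)) := by
  have hσ : 0 < sqDist (halfVec j) x + a + 1 := by linarith [sqDist_nonneg (halfVec j) x]
  have hstep : ∀ (i : Fin d) (b : Bool), (((x + unitStep (i, b)) j : ℤ) : ℝ) + 1 / 2 =
      ((x j : ℝ) + 1 / 2) + if i = j then (if b then 1 else -1) else 0 := by
    intro i b
    by_cases hij : i = j
    · subst hij
      cases b <;> simp [unitStep] <;> ring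
    · simp [unitStep, hij, Ne.symm hij]
  unfold nbrAvg dipole
  rw [Fintype.sum_prod_type]
  simp_rw [Fintype.sum_bool, hstep, rpow_sqDist_add_unitStep hσ (ht _)]
  set σ := (sqDist (halfVec j) x + a + 1) ^ (-((d : ℝ) / 2))
  have : ∀ i, ((x j : ℝ) + 1 / 2 + if i = j then (if true = true then 1 else -1) else 0) *
        (σ * (1 + (if true = true then 1 else -1) * stepRatio (halfVec j) a x i) ^
          (-((d : ℝ) / 2))) +
      ((x j : ℝ) + 1 / 2 + if i = j then (if false = true then 1 else -1) else 0) *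
        (σ * (1 + (if false = true then 1 else -1) * stepRatio (halfVec j) a x i) ^
          (-((d : ℝ) / 2))) =
      σ * ((x j : ℝ) + 1 / 2) * powEven ((d : ℝ) / 2) (stepRatio (halfVec j) a x i) +
        if i = j then - (σ * powOdd ((d : ℝ) / 2) (stepRatio (halfVec j) a x i)) else 0 := by
    intro i
    unfold powEven powOdd
    by_cases hij : i = j
    · subst hij
      simp only [if_true, Bool.false_eq_true, if_false, one_mul, neg_one_mul, ← sub_eq_add_neg]
      ring
    · simp only [hij, if_true, Bool.false_eq_true, if_false, one_mul, neg_one_mul,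
        ← sub_eq_add_neg]
      ring
  simp only [if_true] at this ⊢
  rw [Finset.sum_congr rfl fun i _ => this i, Finset.sum_add_distrib, ← Finset.mul_sum,
    Finset.sum_ite_eq' Finset.univ j]
  simp only [Finset.mem_univ, if_true]
  ring

/-- With κ = d/2 the even part contributes (κ+1)/σ to leading order and the odd part removes at
least 1/σ. What remains matches the first-order term κ/σ of the value at `x`. The shift `a` absorbs
the error, since (κ+1)(a+1) > 8C. -/
lemma exists_dipole_superharmonic [NeZero d] (hd : 3 ≤ d) : ∃ a : ℝ, 16 ≤ a ∧
    ∀ (j : Fin d) (x : Lat d), 0 ≤ x j → nbrAvg (dipole j a) x < dipole j a x := by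
  have hd' : (3 : ℝ) ≤ d := by exact_mod_cast hd
  set κ : ℝ := (d : ℝ) / 2 with hκ
  have hκ0 : 0 < κ := by rw [hκ]; linarith
  obtain ⟨C, hC, h⟩ := exists_powEven_le (p := κ) hκ0.le
  refine ⟨16 + 8 * C, by linarith, fun j x hxj => ?_⟩
  set a := 16 + 8 * C with ha
  have hQ := sqDist_nonneg (halfVec j) x
  obtain ⟨ht, hs⟩ :=
    sum_powEven_stepRatio_le (c := halfVec j) (a := a) (p := κ) (by linarith) hC h x
  rw [nbrAvg_dipole (by linarith) fun i => (ht i).le.trans (by norm_num)]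
  unfold dipole
  rw [← hκ, rpow_sqDist_eq (by linarith)]
  set σ := sqDist (halfVec j) x + a + 1 with hσd
  have hσ : 0 < σ := by linarith
  have hy : (0 : ℝ) < (x j : ℝ) + 1 / 2 := by
    have : (0 : ℝ) ≤ x j := by exact_mod_cast hxj
    linarith
  set y : ℝ := (x j : ℝ) + 1 / 2 with hyd
  have htj : stepRatio (halfVec j) a x j = 2 * y / σ := by
    simp [stepRatio, halfVec, hyd, hσd]
  have hodd : 2 * κ * (2 * y / σ) ≤ powOdd κ (stepRatio (halfVec j) a x j) := by
    have h1 := ht j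
    rw [htj] at h1 ⊢
    exact le_powOdd hκ0.le (by positivity) (by linarith [le_abs_self (2 * y / σ)])
  have h1 := le_one_sub_rpow (p := κ) (t := 1 / σ) hκ0.le (by positivity)
    (by rw [div_lt_one hσ]; linarith)
  have hs' := mul_le_mul_of_nonneg_left hs hy.le
  have hodd' : y / σ ≤ powOdd κ (stepRatio (halfVec j) a x j) / (2 * d) := by
    rw [le_div_iff₀ (by positivity)]
    refine le_trans (le_of_eq ?_) hodd
    rw [hκ]; field_simp
  have h1' := mul_le_mul_of_nonneg_left h1 hy.le
  have key : y * (1 + (2 * κ * (κ + 1) / d * sqDist (halfVec j) x + 8 * C) / σ ^ 2) - y / σ <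
      y * (1 + κ * (1 / σ)) := by
    have e1 : 2 * κ * (κ + 1) / d = κ + 1 := by rw [hκ]; field_simp
    have e2 : y * (1 + (2 * κ * (κ + 1) / d * sqDist (halfVec j) x + 8 * C) / σ ^ 2) - y / σ =
        y * (1 + (((κ + 1) * sqDist (halfVec j) x + 8 * C) / σ ^ 2 - 1 / σ)) := by
      rw [e1]; ring
    rw [e2]
    refine mul_lt_mul_of_pos_left ?_ hy
    rw [add_lt_add_iff_left, sub_lt_iff_lt_add, mul_one_div, ← add_div,
      div_lt_div_iff₀ (by positivity) hσ]
    have : (κ + 1) * sqDist (halfVec j) x + 8 * C < (κ + 1) * σ := by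
      rw [hσd]
      nlinarith
    nlinarith
  calc _ < σ ^ (-κ) * (y * (1 - 1 / σ) ^ (-κ)) :=
        mul_lt_mul_of_pos_left (by linarith) (Real.rpow_pos_of_pos hσ _)
    _ = _ := by ring

lemma abs_dipole_le (j : Fin d) {a : ℝ} (ha : 16 ≤ a) (x : Lat d) :
    |dipole j a x| ≤ (sqDist (halfVec j) x + a) ^ (-(((d : ℝ) - 1) / 2)) := by
  have hpos : 0 < sqDist (halfVec j) x + a := by linarith [sqDist_nonneg (halfVec j) x]
  have h1 : |(x j : ℝ) + 1 / 2| ≤ (sqDist (halfVec j) x + a) ^ (1 / 2 : ℝ) := by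
    rw [← Real.sqrt_eq_rpow]
    refine Real.abs_le_sqrt ?_
    have := sq_le_sqDist (halfVec j) x j
    simp only [halfVec, Pi.single_eq_same] at this
    unfold halfVec
    linarith
  unfold dipole
  rw [abs_mul, abs_of_pos (Real.rpow_pos_of_pos hpos _)]
  calc _ ≤ (sqDist (halfVec j) x + a) ^ (1 / 2 : ℝ) *
        (sqDist (halfVec j) x + a) ^ (-((d : ℝ) / 2)) :=
        mul_le_mul_of_nonneg_right h1 (Real.rpow_nonneg hpos.le _)
    _ = _ := by
        rw [← Real.rpow_add hpos]
        congr 1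
        ring

/-- Reflection in the hyperplane `{x | x j = 0}`. -/
def reflect (j : Fin d) (x : Lat d) : Lat d := Function.update x j (-(x j))

lemma green_reflect [NeZero d] (j : Fin d) (x : Lat d) : green (reflect j x) 0 = green x 0 := by
  have h0 : reflect j (0 : Lat d) = 0 := by
    funext k
    by_cases hk : k = j <;> simp [reflect, hk]
  have hinv : Function.Involutive (reflect j : Lat d → Lat d) := fun x => by
    funext k
    by_cases hk : k = j
    · subst hk; simp [reflect]
    · simp [reflect, hk]
  have hτ : Function.Involutive
      (fun s : Fin d × Bool => if s.1 = j then (s.1, !s.2) else s) := fun s => by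
    obtain ⟨i, b⟩ := s
    by_cases hs : i = j <;> simp [hs]
  conv_lhs => rw [← h0]
  refine green_map (reflect j) hinv.injective (hτ.toPerm _) (fun x s => ?_) x 0
  obtain ⟨i, b⟩ := s
  funext k
  by_cases hi : i = j
  · subst hi
    by_cases hk : k = i
    · subst hk
      cases b <;> simp [reflect, unitStep, Function.Involutive.toPerm] <;> ring
    · simp [reflect, unitStep, hk, Function.Involutive.toPerm]
  · by_cases hk : k = j
    · subst hk
      simp [reflect, unitStep, hi, Ne.symm hi, Function.Involutive.toPerm]
    · simp [reflect, unitStep, hk, hi, Function.Involutive.toPerm]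

/-- The discrete derivative `g(x) - g(x + e_j)` of the Green function. -/
def greenDiff [NeZero d] (j : Fin d) (x : Lat d) : ℝ :=
  green x 0 - green (x + unitStep (j, true)) 0

/-- Both g(x) - g(x + e_j) and the dipole are antisymmetric across the hyperplane x_j = -1/2, and on
x_j ≥ 0 the former is harmonic except for a unit source at 0. Hence it lies between 0 and a multiple
of the dipole there, and reflection gives the other half space. -/
lemma exists_abs_greenDiff_le [NeZero d] (hd : 3 ≤ d) (j : Fin d) : ∃ C : ℝ, 0 ≤ C ∧
    ∀ x : Lat d, x ≠ 0 → |greenDiff j x| ≤ C / ‖x‖ ^ (d - 1) := by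
  obtain ⟨a, ha, h⟩ := exists_dipole_superharmonic hd
  have hd' : (3 : ℝ) ≤ d := by exact_mod_cast hd
  have hD0 : Tendsto (greenDiff j) cofinite (𝓝 0) := by
    have h1 := tendsto_green_cofinite hd (0 : Lat d)
    have h2 : Tendsto (fun x : Lat d => x + unitStep (j, true)) cofinite cofinite :=
      (add_left_injective _).tendsto_cofinite
    have h3 := h1.sub (h1.comp h2)
    rw [sub_zero] at h3
    exact h3
  have hv0 : Tendsto (dipole j a) cofinite (𝓝 0) := by
    refine squeeze_zero_norm (fun x => abs_dipole_le j ha x) ?_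
    exact tendsto_rpow_sqDist_cofinite (sqDist_div_le_halfVec j) a (by linarith)
  have hDanti : ∀ x : Lat d, x j = 0 → greenDiff j (x + unitStep (j, false)) = - greenDiff j x := by
    intro x hx
    have e1 : x + unitStep (j, false) + unitStep (j, true) = x := by
      rw [show unitStep (j, false) = -unitStep (j, true) from unitStep_not j true]
      abel
    have e2 : reflect j (x + unitStep (j, true)) = x + unitStep (j, false) := by
      funext k
      by_cases hk : k = j
      · subst hk; simp [reflect, unitStep, hx]
      · simp [reflect, unitStep, hk]
    unfold greenDiff
    rw [e1, ← e2, green_reflect]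
    ring
  have hvanti : ∀ x : Lat d, x j = 0 → dipole j a (x + unitStep (j, false)) = - dipole j a x := by
    intro x hx
    unfold dipole
    rw [sqDist_add_unitStep]
    simp [hx, unitStep, halfVec]
    ring
  have hDavg : ∀ x : Lat d, 0 ≤ x j →
      greenDiff j x = (if x = 0 then 1 else 0) + nbrAvg (greenDiff j) x := by
    intro x hx
    -- The second source, at -e_j, lies outside the half space.
    have hne : x + unitStep (j, true) ≠ 0 := by
      intro h0
      have := congrFun h0 j
      simp [unitStep] at this
      omega
    have e1 := green_eq_add_nbrAvg hd x 0
    have e2 := green_eq_add_nbrAvg hd (x + unitStep (j, true)) 0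
    have e3 : nbrAvg (greenDiff j) x = nbrAvg (fun u => green u 0) x -
        nbrAvg (fun u => green u 0) (x + unitStep (j, true)) := by
      unfold greenDiff
      rw [nbrAvg_sub]
      congr 1
      unfold nbrAvg
      simp only [add_right_comm]
    rw [e3]
    simp only [hne, if_false, zero_add] at e2
    unfold greenDiff
    linarith
  have hpos : 0 < dipole j a 0 - nbrAvg (dipole j a) 0 := sub_pos.2 (h j 0 le_rfl)
  set M := (dipole j a 0 - nbrAvg (dipole j a) 0)⁻¹ with hM
  have hM0 : 0 < M := inv_pos.2 hpos
  have hDnonneg : ∀ x : Lat d, 0 ≤ x j → 0 ≤ greenDiff j x := by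
    refine min_principle_halfSpace j hD0 (fun x hx => ?_) hDanti
    rw [hDavg x hx]
    have : (0 : ℝ) ≤ if x = 0 then 1 else 0 := by positivity
    linarith
  have hDle : ∀ x : Lat d, 0 ≤ x j → greenDiff j x ≤ M * dipole j a x := by
    intro x hx
    have := min_principle_halfSpace (w := fun x => M * dipole j a x - greenDiff j x) j
      (by simpa using (hv0.const_mul M).sub hD0) (fun x hx => ?_)
      (fun x hx => by simp only [hDanti x hx, hvanti x hx]; ring) x hx
    · linarith
    · rw [nbrAvg_sub, nbrAvg_const_mul]
      have h1 := hDavg x hx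
      have h2 : M * nbrAvg (dipole j a) x + (if x = 0 then 1 else 0) ≤ M * dipole j a x := by
        split_ifs with hx0
        · subst hx0
          have : M * (dipole j a 0 - nbrAvg (dipole j a) 0) = 1 := inv_mul_cancel₀ hpos.ne'
          linarith
        · have := mul_le_mul_of_nonneg_left (h j x hx).le hM0.le
          linarith
      linarith
  set B : Lat d → ℝ := fun x => M * (sqDist (halfVec j) x + a) ^ (-(((d : ℝ) - 1) / 2)) with hB
  have habs : ∀ x : Lat d, |greenDiff j x| ≤ B x := by
    have hH : ∀ x : Lat d, 0 ≤ x j → |greenDiff j x| ≤ B x := fun x hx => by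
      rw [abs_of_nonneg (hDnonneg x hx)]
      refine (hDle x hx).trans (mul_le_mul_of_nonneg_left ?_ hM0.le)
      exact (le_abs_self _).trans (abs_dipole_le j ha x)
    intro x
    rcases le_or_gt 0 (x j) with hx | hx
    · exact hH x hx
    -- `x'` is the mirror image of `x` in the hyperplane x_j = -1/2.
    · set x' := reflect j (x + unitStep (j, true)) with hx'
      have hx'j : x' j = -(x j) - 1 := by
        simp [hx', reflect, unitStep]; ring
      have e1 : greenDiff j x = - greenDiff j x' := by
        have e2 : x' + unitStep (j, true) = reflect j x := by
          funext k
          by_cases hk : k = j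
          · subst hk; simp [hx', reflect, unitStep]
          · simp [hx', reflect, unitStep, hk]
        unfold greenDiff
        rw [e2, hx', green_reflect, green_reflect]
        ring
      have e3 : sqDist (halfVec j) x' = sqDist (halfVec j) x := by
        refine Finset.sum_congr rfl fun k _ => ?_
        by_cases hk : k = j
        · subst hk
          rw [hx'j]
          push_cast
          simp only [halfVec, Pi.single_eq_same]
          ring
        · simp [hx', reflect, unitStep, hk]
      rw [e1, abs_neg]
      refine (hH x' (by omega)).trans (le_of_eq ?_)
      simp only [hB, e3]
  refine ⟨M * (1 / 2) ^ (-((d : ℝ) - 1)), by positivity, fun x hx => (habs x).trans ?_⟩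
  have hn : 0 < ‖x‖ := norm_pos_iff.2 hx
  have hcast : ((d : ℝ) - 1) / 2 = ((d - 1 : ℕ) : ℝ) / 2 := by
    rw [Nat.cast_sub (by omega)]; norm_num
  rw [mul_div_assoc]
  refine mul_le_mul_of_nonneg_left ?_ hM0.le
  calc (sqDist (halfVec j) x + a) ^ (-(((d : ℝ) - 1) / 2))
      ≤ ((1 / 2) ^ 2 * ‖x‖ ^ 2) ^ (-(((d : ℝ) - 1) / 2)) :=
        Real.rpow_le_rpow_of_nonpos (by positivity)
          (by linarith [norm_sq_le_sqDist x, sqDist_div_le_halfVec j x]) (by linarith)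
    _ = (1 / 2) ^ (-((d : ℝ) - 1)) / ‖x‖ ^ (d - 1) := by
        rw [Real.mul_rpow (by positivity) (by positivity), ← Real.rpow_natCast (1 / 2) 2,
          ← Real.rpow_mul (by norm_num), hcast, rpow_sq_neg_half hn.le, div_eq_mul_inv]
        congr 2
        rw [Nat.cast_sub (by omega)]
        push_cast
        ring

lemma exists_green_gradient_le [NeZero d] (hd : 3 ≤ d) : ∃ C : ℝ, 0 < C ∧
    ∀ (x : Lat d) (s : Fin d × Bool), x ≠ 0 →
      |green (x + unitStep s) 0 - green x 0| ≤ C / ‖x‖ ^ (d - 1) := by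
  choose C hC0 hC using exists_abs_greenDiff_le hd
  refine ⟨1 + ∑ j, C j, ?_, fun x s hx => ?_⟩
  · linarith [Finset.sum_nonneg fun j (_ : j ∈ Finset.univ) => hC0 j]
  have hle : ∀ j, C j ≤ 1 + ∑ j, C j := fun j => by
    have := Finset.single_le_sum (f := C) (fun j _ => hC0 j) (Finset.mem_univ j)
    linarith
  obtain ⟨j, b⟩ := s
  have hn : 0 < ‖x‖ := norm_pos_iff.2 hx
  have key : |green (x + unitStep (j, b)) 0 - green x 0| ≤ C j / ‖x‖ ^ (d - 1) := by
    cases b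
    · have e : green (x + unitStep (j, false)) 0 = green (-x + unitStep (j, true)) 0 := by
        rw [← green_neg (x + unitStep (j, false)), neg_zero,
          show unitStep (j, false) = -unitStep (j, true) from unitStep_not j true]
        congr 1
        abel
      have e2 : green x 0 = green (-x) 0 := by rw [← green_neg x, neg_zero]
      rw [e, e2, abs_sub_comm, ← norm_neg x]
      exact hC j (-x) (neg_ne_zero.2 hx)
    · rw [abs_sub_comm]
      exact hC j x hx
  refine key.trans ?_
  gcongr
  exact hle j

lemma exists_abs_green_sub_le [NeZero d] (hd : 3 ≤ d) : ∃ C : ℝ, 0 < C ∧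
    ∀ (x y : Lat d) (R : ℝ), 0 < R → (∀ u ∈ Set.uIcc x y, R ≤ ‖u‖) →
      |green x 0 - green y 0| ≤ C * ‖x - y‖ / R ^ (d - 1) := by
  obtain ⟨C, hC, h⟩ := exists_green_gradient_le hd
  have hd' : 0 < (d : ℝ) := Nat.cast_pos.2 (NeZero.pos d)
  refine ⟨C * d, by positivity, fun x y R hR hu => ?_⟩
  have := abs_sub_le_of_step_le (f := fun x => green x 0) (M := C / R ^ (d - 1)) x y
    (fun u hu' s => ?_)
  · refine this.trans ?_
    calc (stepDist x y : ℝ) * (C / R ^ (d - 1)) ≤ (d * ‖x - y‖) * (C / R ^ (d - 1)) := by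
          gcongr
          exact stepDist_le x y
      _ = _ := by ring
  · have hRu := hu u hu'
    have hu0 : u ≠ 0 := norm_pos_iff.1 (hR.trans_le hRu)
    refine (h u s hu0).trans ?_
    gcongr

/-! ### Hitting probabilities, equilibrium measure and capacity -/

/-- The probability that the walk started in `x` ever visits `A`. -/
def hitProb [NeZero d] (A : Finset (Lat d)) (x : Lat d) : ℝ :=
  (walkLaw x).real {w | ∃ n, w n ∈ A}

lemma measurableSet_hit (A : Finset (Lat d)) :
    MeasurableSet {w : ℕ → Lat d | ∃ n, w n ∈ A} := by
  rw [Set.ofPred_exists]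
  exact MeasurableSet.iUnion fun n => measurableSet_pos_mem n A

lemma hitProb_of_mem [NeZero d] {A : Finset (Lat d)} {x : Lat d} (hx : x ∈ A) :
    hitProb A x = 1 := by
  unfold hitProb
  rw [← probReal_univ (μ := walkLaw x)]
  refine measureReal_congr ?_
  filter_upwards [walkLaw_start x] with w hw
  apply propext
  change (∃ n, w n ∈ A) ↔ True
  exact iff_true_intro ⟨0, by rwa [hw]⟩

lemma hitProb_of_notMem [NeZero d] {A : Finset (Lat d)} {x : Lat d} (hx : x ∉ A) :
    hitProb A x = nbrAvg (hitProb A) x := by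
  unfold hitProb
  rw [walkLaw_real_eq x (measurableSet_hit A)]
  refine nbrAvg_congr fun s => ?_
  congr 1
  ext w
  simp only [Set.mem_ofPred_eq]
  constructor
  · rintro ⟨n, hn⟩
    cases n with
    | zero => exact absurd hn hx
    | succ n => exact ⟨n, hn⟩
  · rintro ⟨n, hn⟩
    exact ⟨n + 1, hn⟩

/-- The escape probability from a point of A is the neighbour average of 1 - `hitProb`. So e_A is
minus the discrete Laplacian of the hitting probability. -/
lemma equilibrium_eq [NeZero d] (A : Finset (Lat d)) (x : Lat d) :
    equilibrium A x = hitProb A x - nbrAvg (hitProb A) x := by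
  by_cases hx : x ∈ A
  · have hm : MeasurableSet {w : ℕ → Lat d | ∀ n : ℕ, 1 ≤ n → w n ∉ A} := by
      simp only [Set.ofPred_forall]
      exact MeasurableSet.iInter fun n => MeasurableSet.iInter fun _ =>
        (measurableSet_pos_mem n A).compl
    rw [hitProb_of_mem hx, equilibrium, if_pos hx, walkLaw_real_eq x hm,
      ← nbrAvg_const 1 x, ← nbrAvg_sub]
    refine nbrAvg_congr fun s => ?_
    rw [hitProb, ← probReal_compl_eq_one_sub (measurableSet_hit A)]
    congr 1
    ext w
    simp only [Set.mem_ofPred_eq, Set.mem_compl_iff, not_exists]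
    constructor
    · intro h n
      exact h (n + 1) (by omega)
    · intro h n hn
      obtain ⟨m, rfl⟩ : ∃ m, n = m + 1 := ⟨n - 1, by omega⟩
      exact h m
  · rw [← hitProb_of_notMem hx, equilibrium, if_neg hx, sub_self]

lemma hitProb_le_sum_green [NeZero d] (hd : 3 ≤ d) (A : Finset (Lat d)) (x : Lat d) :
    hitProb A x ≤ ∑ y ∈ A, green x y := by
  have hset : {w : ℕ → Lat d | ∃ n, w n ∈ A} = ⋃ y ∈ A, ⋃ n, {w | w n = y} := by
    ext w
    simp only [Set.mem_ofPred_eq, Set.mem_iUnion, exists_prop]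
    constructor
    · rintro ⟨n, hn⟩
      exact ⟨_, hn, n, rfl⟩
    · rintro ⟨y, hy, n, rfl⟩
      exact ⟨n, hy⟩
  unfold hitProb
  rw [hset]
  refine (measureReal_biUnion_finset_le _ _).trans (Finset.sum_le_sum fun y _ => ?_)
  rw [measureReal_def, green]
  refine ENNReal.toReal_le_of_le_ofReal (green_nonneg x y) ?_
  refine (measure_iUnion_le _).trans (le_of_eq ?_)
  rw [ENNReal.ofReal_tsum_of_nonneg (fun n => measureReal_nonneg) (summable_transProb hd x y)]
  simp

lemma hitProb_nonneg [NeZero d] (A : Finset (Lat d)) (x : Lat d) : 0 ≤ hitProb A x :=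
  measureReal_nonneg

lemma tendsto_sum_green_cofinite [NeZero d] (hd : 3 ≤ d) (A : Finset (Lat d)) (e : Lat d → ℝ) :
    Tendsto (fun x => ∑ y ∈ A, green x y * e y) cofinite (𝓝 0) := by
  have := tendsto_finsetSum A fun y _ => (tendsto_green_cofinite hd y).mul_const (e y)
  simpa using this

/-- Both sides vanish at infinity and have Laplacian -e_A, hence they coincide. This replaces the
last-exit decomposition. -/
lemma sum_green_mul_equilibrium [NeZero d] (hd : 3 ≤ d) (A : Finset (Lat d)) (x : Lat d) :
    ∑ y ∈ A, green x y * equilibrium A y = hitProb A x := by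
  have h0 : Tendsto (hitProb A) cofinite (𝓝 0) :=
    squeeze_zero (hitProb_nonneg A) (hitProb_le_sum_green hd A)
      (by simpa using tendsto_sum_green_cofinite hd A fun _ => 1)
  have hw := eq_zero_of_harmonic
    (w := fun x => hitProb A x - ∑ y ∈ A, green x y * equilibrium A y)
    (by simpa using h0.sub (tendsto_sum_green_cofinite hd A (equilibrium A)))
    (fun x _ => ?_) x
  · linarith
  · rw [nbrAvg_sub, nbrAvg_sum]
    have h1 : ∀ y, nbrAvg (fun u => green u y * equilibrium A y) x =
        green x y * equilibrium A y - if x = y then equilibrium A y else 0 := fun y => by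
      have := nbrAvg_const_mul (equilibrium A y) (fun u => green u y) x
      simp only [mul_comm (equilibrium A y)] at this
      rw [this, green_eq_add_nbrAvg hd x y]
      split_ifs <;> ring
    simp only [h1, Finset.sum_sub_distrib, Finset.sum_ite_eq]
    have h2 := equilibrium_eq A x
    split_ifs with hx
    · linarith
    · rw [hitProb_of_notMem hx]
      ring

lemma equilibrium_nonneg [NeZero d] (A : Finset (Lat d)) (x : Lat d) : 0 ≤ equilibrium A x := by
  unfold equilibrium
  split_ifs
  exacts [measureReal_nonneg, le_rfl]

lemma capacity_nonneg [NeZero d] (A : Finset (Lat d)) : 0 ≤ capacity A :=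
  Finset.sum_nonneg fun x _ => equilibrium_nonneg A x

lemma sum_sum_equilibrium_mul_green [NeZero d] (hd : 3 ≤ d) (A : Finset (Lat d)) :
    ∑ x ∈ A, ∑ y ∈ A, equilibrium A x * equilibrium A y * green x y = capacity A := by
  refine Finset.sum_congr rfl fun x hx => ?_
  have := sum_green_mul_equilibrium hd A x
  rw [hitProb_of_mem hx] at this
  calc _ = equilibrium A x * ∑ y ∈ A, green x y * equilibrium A y := by
        rw [Finset.mul_sum]
        exact Finset.sum_congr rfl fun y _ => by ring
    _ = _ := by rw [this, mul_one]

lemma capacity_pos [NeZero d] (hd : 3 ≤ d) {A : Finset (Lat d)} (hA : A.Nonempty) :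
    0 < capacity A := by
  refine lt_of_le_of_ne (capacity_nonneg A) fun h => ?_
  obtain ⟨x, hx⟩ := hA
  have h0 := (Finset.sum_eq_zero_iff_of_nonneg fun x _ => equilibrium_nonneg A x).1 h.symm
  have := sum_green_mul_equilibrium hd A x
  rw [hitProb_of_mem hx, Finset.sum_eq_zero fun y hy => by rw [h0 y hy, mul_zero]] at this
  exact zero_ne_one this

lemma equilibrium_anti [NeZero d] {A C : Finset (Lat d)} (h : A ⊆ C) {x : Lat d} (hx : x ∈ A) :
    equilibrium C x ≤ equilibrium A x := by
  rw [equilibrium, equilibrium, if_pos hx, if_pos (h hx)]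
  exact measureReal_mono fun w hw n hn hnA => hw n hn (h hnA)

lemma sum_biUnion_le_sum_sum {ι α : Type*} [DecidableEq ι] [DecidableEq α] (S : Finset ι)
    (B : ι → Finset α) {f : α → ℝ} (hf : ∀ x, 0 ≤ f x) :
    ∑ x ∈ S.biUnion B, f x ≤ ∑ z ∈ S, ∑ x ∈ B z, f x := by
  induction S using Finset.induction_on with
  | empty => simp
  | insert z S hz ih =>
    rw [Finset.biUnion_insert, Finset.sum_insert hz]
    have h1 := Finset.sum_union_inter (s₁ := B z) (s₂ := S.biUnion B) (f := f)
    have h2 : 0 ≤ ∑ x ∈ B z ∩ S.biUnion B, f x := Finset.sum_nonneg fun x _ => hf x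
    linarith

lemma capacity_biUnion_le [NeZero d] {ι : Type*} [DecidableEq ι] (S : Finset ι)
    (B : ι → Finset (Lat d)) : capacity (S.biUnion B) ≤ ∑ z ∈ S, capacity (B z) := by
  calc capacity (S.biUnion B) ≤ ∑ z ∈ S, ∑ x ∈ B z, equilibrium (S.biUnion B) x :=
        sum_biUnion_le_sum_sum _ _ (fun _ => equilibrium_nonneg _ _)
    _ ≤ _ := Finset.sum_le_sum fun z hz => Finset.sum_le_sum fun x hx =>
        equilibrium_anti (Finset.subset_biUnion_of_mem B hz) hx

/-! ### Cubes and the capacity of a single box -/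

lemma mem_cube {z x : Lat d} {a b : ℤ} : x ∈ cube z a b ↔ ∀ i, z i + a ≤ x i ∧ x i < z i + b := by
  simp [cube]

lemma norm_sub_le_of_mem_cube {z x y : Lat d} {a b : ℤ} (hab : a < b) (hx : x ∈ cube z a b)
    (hy : y ∈ cube z a b) : ‖x - y‖ + 1 ≤ (b - a : ℤ) := by
  rw [mem_cube] at hx hy
  suffices ‖x - y‖ ≤ ((b - a - 1 : ℤ) : ℝ) by push_cast at this ⊢; linarith
  refine (pi_norm_le_iff_of_nonneg (by exact_mod_cast (by omega : (0:ℤ) ≤ b - a - 1))).2 fun i => ?_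
  rw [Int.norm_eq_abs, ← Int.cast_abs]
  have h1 := hx i
  have h2 := hy i
  have : |(x - y) i| ≤ b - a - 1 := by
    rw [abs_le, Pi.sub_apply]; omega
  exact_mod_cast this

/-- The equilibrium potential is 1 at the corner `z`, while every g(z,y) with y in the box is at
least c/L^(d-2). -/
lemma exists_capacity_boxB_le [NeZero d] (hd : 3 ≤ d) : ∃ C : ℝ, 0 < C ∧
    ∀ (L : ℕ) (z : Lat d), 1 ≤ L → capacity (boxB L z) ≤ C * (L : ℝ) ^ (d - 2) := by
  obtain ⟨c, hc, h⟩ := exists_le_green hd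
  refine ⟨1 / c, by positivity, fun L z hL => ?_⟩
  have hLpos : (0 : ℝ) < L := by exact_mod_cast hL
  have hz : z ∈ boxB L z := by
    rw [boxB, mem_cube]; intro i; omega
  have h1 := sum_green_mul_equilibrium hd (boxB L z) z
  rw [hitProb_of_mem hz] at h1
  have h2 : capacity (boxB L z) * (c / (L : ℝ) ^ (d - 2)) ≤ 1 := by
    rw [← h1, capacity, Finset.sum_mul]
    refine Finset.sum_le_sum fun y hy => ?_
    rw [mul_comm]
    refine mul_le_mul_of_nonneg_right ((h z y).trans' ?_) (equilibrium_nonneg _ _)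
    have := norm_sub_le_of_mem_cube (by omega) hz hy
    push_cast at this
    gcongr
    linarith
  rw [mul_div_assoc', div_le_one (by positivity)] at h2
  rw [one_div, inv_mul_eq_div, le_div_iff₀ hc]
  exact h2

/-! ### Exit distributions of finite sets -/

lemma exitTime_eq_iff (U : Finset (Lat d)) (w : ℕ → Lat d) (n : ℕ) :
    exitTime U w = n ↔ (w n ∉ U ∧ ∀ k < n, w k ∈ U) ∨ (n = 0 ∧ ∀ k, w k ∈ U) := by
  unfold exitTime
  by_cases h : ∃ k, w k ∉ U
  · have hmem : w (sInf {n | w n ∉ U}) ∉ U := Nat.sInf_mem (s := {n | w n ∉ U}) h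
    constructor
    · rintro rfl
      exact Or.inl ⟨hmem, fun k hk => by simpa using Nat.notMem_of_lt_sInf hk⟩
    · rintro (⟨h1, h2⟩ | ⟨-, h2⟩)
      · refine le_antisymm (Nat.sInf_le h1) (not_lt.1 fun hlt => hmem (h2 _ hlt))
      · exact absurd (h2 _) h.choose_spec
  · have h' : ∀ k, w k ∈ U := by simpa using h
    have : {n | w n ∉ U} = ∅ := by
      ext k; simp [h' k]
    rw [this, Nat.sInf_empty]
    constructor
    · rintro rfl
      exact Or.inr ⟨rfl, h'⟩
    · rintro (⟨h1, -⟩ | ⟨h1, -⟩)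
      · exact absurd (h' _) h1
      · exact h1.symm

lemma measurable_exitPos (U : Finset (Lat d)) :
    Measurable fun w : ℕ → Lat d => w (exitTime U w) := by
  have hset : ∀ n, MeasurableSet {w : ℕ → Lat d | exitTime U w = n} := by
    intro n
    have : {w : ℕ → Lat d | exitTime U w = n} =
        ({w | w n ∈ U}ᶜ ∩ ⋂ k, ⋂ (_ : k < n), {w | w k ∈ U}) ∪
          ({_w | n = 0} ∩ ⋂ k, {w | w k ∈ U}) := by
      ext w
      simp [exitTime_eq_iff]
    rw [this]
    exact ((measurableSet_pos_mem n U).compl.inter (MeasurableSet.iInter fun k =>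
      MeasurableSet.iInter fun _ => measurableSet_pos_mem k U)).union
      ((MeasurableSet.const _).inter (MeasurableSet.iInter fun k => measurableSet_pos_mem k U))
  refine measurable_to_countable' fun y => ?_
  have : (fun w : ℕ → Lat d => w (exitTime U w)) ⁻¹' {y} =
      ⋃ n, {w | exitTime U w = n} ∩ {w | w n = y} := by
    ext w
    simp
  rw [this]
  exact MeasurableSet.iUnion fun n => (hset n).inter (measurableSet_pos_eq n y)

/-- The distribution `P_x[X_T = y]` of the exit position from `U`. -/
def exitProb [NeZero d] (U : Finset (Lat d)) (x y : Lat d) : ℝ :=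
  (walkLaw x).real {w | w (exitTime U w) = y}

lemma exitProb_nonneg [NeZero d] (U : Finset (Lat d)) (x y : Lat d) : 0 ≤ exitProb U x y :=
  measureReal_nonneg

lemma measurableSet_exitPos_eq (U : Finset (Lat d)) (y : Lat d) :
    MeasurableSet {w : ℕ → Lat d | w (exitTime U w) = y} :=
  measurableSet_eq_fun (measurable_exitPos U) measurable_const

/-- The transition probabilities are summable, so the chance of being in a finite set at time n
tends to 0. -/
lemma ae_exists_notMem [NeZero d] (hd : 3 ≤ d) (U : Finset (Lat d)) (x : Lat d) :
    ∀ᵐ w ∂(walkLaw x), ∃ n, w n ∉ U := by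
  have h0 : (walkLaw x).real {w | ¬ ∃ n, w n ∉ U} = 0 := by
    refine le_antisymm ?_ measureReal_nonneg
    have ht : Tendsto (fun n => ∑ y ∈ U, transProb n x y) atTop (𝓝 0) := by
      simpa using tendsto_finsetSum U fun y _ => (summable_transProb hd x y).tendsto_atTop_zero
    refine ge_of_tendsto' ht fun n => ?_
    have hsub : {w : ℕ → Lat d | ¬ ∃ n, w n ∉ U} ⊆ ⋃ y ∈ U, {w | w n = y} := fun w hw => by
      have : ∀ n, w n ∈ U := by simpa using hw
      simpa using this n
    exact (measureReal_mono hsub (measure_ne_top _ _)).trans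
      (measureReal_biUnion_finset_le (μ := walkLaw x) U fun y => {w : ℕ → Lat d | w n = y})
  rw [ae_iff]
  simpa [measureReal_def, ENNReal.toReal_eq_zero_iff] using h0

lemma exitProb_of_notMem [NeZero d] {U : Finset (Lat d)} {x : Lat d} (hx : x ∉ U) (y : Lat d) :
    exitProb U x y = if x = y then 1 else 0 := by
  rw [← transProb_zero]
  unfold exitProb transProb
  refine measureReal_congr ?_
  filter_upwards [walkLaw_start x] with w hw
  have : exitTime U w = 0 := by
    rw [exitTime_eq_iff]
    exact Or.inl ⟨by rwa [hw], by simp⟩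
  apply propext
  change w (exitTime U w) = y ↔ w 0 = y
  rw [this]

lemma exitProb_of_mem [NeZero d] (hd : 3 ≤ d) {U : Finset (Lat d)} {x : Lat d} (hx : x ∈ U)
    (y : Lat d) : exitProb U x y = nbrAvg (fun u => exitProb U u y) x := by
  unfold exitProb
  rw [walkLaw_real_eq x (measurableSet_exitPos_eq U y)]
  refine nbrAvg_congr fun s => measureReal_congr ?_
  -- A path that never leaves U has default exit time 0, which would break the shift of the exit
  -- time by one; such paths are discarded as a null set.
  filter_upwards [ae_exists_notMem hd U (x + unitStep s)] with w hw
  have : exitTime U (consSeq x w) = exitTime U w + 1 := by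
    have h := (exitTime_eq_iff U w (exitTime U w)).1 rfl
    rw [exitTime_eq_iff]
    rcases h with ⟨h1, h2⟩ | ⟨-, h2⟩
    · refine Or.inl ⟨h1, fun k hk => ?_⟩
      cases k with
      | zero => exact hx
      | succ k => exact h2 k (by omega)
    · exact absurd (h2 _) hw.choose_spec
  apply propext
  change consSeq x w (exitTime U (consSeq x w)) = y ↔ w (exitTime U w) = y
  rw [this, consSeq_succ]

/-- The outer boundary of a finite set. -/
def outerBoundary (U : Finset (Lat d)) : Finset (Lat d) :=
  (U.biUnion fun u => Finset.univ.image fun s => u + unitStep s) \ U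

lemma notMem_of_mem_outerBoundary {U : Finset (Lat d)} {y : Lat d} (hy : y ∈ outerBoundary U) :
    y ∉ U := (Finset.mem_sdiff.1 hy).2

lemma add_unitStep_mem_outerBoundary {U : Finset (Lat d)} {x : Lat d} (hx : x ∈ U)
    {s : Fin d × Bool} (hs : x + unitStep s ∉ U) : x + unitStep s ∈ outerBoundary U :=
  Finset.mem_sdiff.2 ⟨Finset.mem_biUnion.2
    ⟨x, hx, Finset.mem_image.2 ⟨s, Finset.mem_univ _, rfl⟩⟩, hs⟩

/-- Optional stopping for harmonic functions, proved as uniqueness for the Dirichlet problem. The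
difference of the two sides vanishes on the outer boundary, so its extension by zero has finite
support and is harmonic in U. -/
lemma sum_exitProb_mul [NeZero d] (hd : 3 ≤ d) {U : Finset (Lat d)} {f : Lat d → ℝ}
    (hf : ∀ x ∈ U, nbrAvg f x = f x) {x : Lat d} (hx : x ∈ U) :
    ∑ y ∈ outerBoundary U, exitProb U x y * f y = f x := by
  set F : Lat d → ℝ := fun x => ∑ y ∈ outerBoundary U, exitProb U x y * f y - f x with hF
  set w : Lat d → ℝ := fun x => if x ∈ U then F x else 0 with hw
  have hFw : ∀ x, x ∈ U ∨ x ∈ outerBoundary U → w x = F x := by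
    rintro x (hx | hx)
    · simp [hw, hx]
    · have hxU := notMem_of_mem_outerBoundary hx
      simp [hw, hxU, hF, exitProb_of_notMem hxU, hx]
  have h0 : Tendsto w cofinite (𝓝 0) := by
    refine tendsto_nhds_of_eventually_eq ?_
    rw [eventually_cofinite]
    refine U.finite_toSet.subset fun y hy => ?_
    by_contra hyU
    exact hy (by simp only [hw]; exact if_neg hyU)
  have := eq_zero_of_harmonic h0 (fun x hx => ?_) x
  · rw [hFw x (Or.inl hx)] at this
    simp only [hF] at this
    linarith
  · have hxU : x ∈ U := by
      by_contra hxU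
      exact hx (if_neg hxU)
    have h1 : nbrAvg w x = nbrAvg F x := nbrAvg_congr fun s => by
      refine hFw _ ?_
      by_cases hs : x + unitStep s ∈ U
      · exact Or.inl hs
      · exact Or.inr (add_unitStep_mem_outerBoundary hxU hs)
    rw [h1, hFw x (Or.inl hxU)]
    simp only [hF]
    rw [nbrAvg_sub, nbrAvg_sum, hf x hxU]
    congr 1
    refine Finset.sum_congr rfl fun y _ => ?_
    have := nbrAvg_const_mul (f y) (fun u => exitProb U u y) x
    simp only [mul_comm (f y)] at this
    rw [this, ← exitProb_of_mem hd hxU]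

lemma sum_exitProb [NeZero d] (hd : 3 ≤ d) {U : Finset (Lat d)} {x : Lat d} (hx : x ∈ U) :
    ∑ y ∈ outerBoundary U, exitProb U x y = 1 := by
  simpa using sum_exitProb_mul hd (f := fun _ => 1) (fun x _ => nbrAvg_const 1 x) hx

lemma sum_exitProb_mul_green [NeZero d] (hd : 3 ≤ d) {U : Finset (Lat d)} {x v : Lat d}
    (hx : x ∈ U) (hv : v ∉ U) :
    ∑ y ∈ outerBoundary U, exitProb U x y * green v y = green v x := by
  simp only [green_comm v]
  refine sum_exitProb_mul hd (f := fun y => green y v) (fun u hu => ?_) hx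
  rw [green_eq_add_nbrAvg hd u v, if_neg (by rintro rfl; exact hv hu), zero_add]

lemma ae_exitPos_mem [NeZero d] (hd : 3 ≤ d) {U : Finset (Lat d)} {x : Lat d} (hx : x ∈ U) :
    ∀ᵐ w ∂(walkLaw x), w (exitTime U w) ∈ outerBoundary U := by
  have hm : MeasurableSet {w : ℕ → Lat d | w (exitTime U w) ∈ outerBoundary U} :=
    measurable_exitPos U (outerBoundary U).measurableSet
  have h1 : (walkLaw x).real {w | w (exitTime U w) ∈ outerBoundary U} = 1 := by
    rw [← sum_exitProb hd hx]
    have hset : {w : ℕ → Lat d | w (exitTime U w) ∈ outerBoundary U} =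
        ⋃ y ∈ outerBoundary U, {w | w (exitTime U w) = y} := by
      ext w; simp
    rw [hset, measureReal_biUnion_finset]
    · rfl
    · intro y _ z _ hyz
      exact Set.disjoint_left.2 fun w hw hw' => hyz (hw.symm.trans hw')
    · exact fun y _ => measurableSet_exitPos_eq U y
  rw [ae_iff]
  have h2 := probReal_compl_eq_one_sub (μ := walkLaw x) hm
  rw [h1, sub_self] at h2
  have h3 : (walkLaw x) {w | w (exitTime U w) ∈ outerBoundary U}ᶜ = 0 := by
    simpa [measureReal_def, ENNReal.toReal_eq_zero_iff] using h2
  exact h3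

/-- The harmonic average becomes a finite linear combination of field values, so Gaussianity and
covariances are read off from the field. -/
lemma harmonicAverage_eq_sum [NeZero d] (hd : 3 ≤ d) {U : Finset (Lat d)} {x : Lat d}
    (hx : x ∈ U) (φ : Lat d → ℝ) :
    harmonicAverage U φ x = ∑ y ∈ outerBoundary U, exitProb U x y * φ y := by
  unfold harmonicAverage
  have : ∀ᵐ w ∂(walkLaw x), φ (w (exitTime U w)) =
      ∑ y ∈ outerBoundary U, ({w : ℕ → Lat d | w (exitTime U w) = y}).indicator
        (fun _ => φ y) w := by
    filter_upwards [ae_exitPos_mem hd hx] with w hw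
    rw [Finset.sum_eq_single (w (exitTime U w))]
    · simp
    · intro y _ hy
      exact Set.indicator_of_notMem (fun h : w (exitTime U w) = y => hy h.symm) _
    · exact fun h => absurd hw h
  rw [integral_congr_ae this, integral_finsetSum]
  · refine Finset.sum_congr rfl fun y _ => ?_
    rw [integral_indicator_const _ (measurableSet_exitPos_eq U y)]
    rfl
  · exact fun y _ => (integrable_const _).indicator (measurableSet_exitPos_eq U y)

/-! ### Dyadic chaining -/

/-- Rounding down, relative to `b`, to multiples of `2 ^ k`. -/
def dyadicRound (b : Lat d) (k : ℕ) (x : Lat d) : Lat d :=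
  fun i => b i + 2 ^ k * ((x i - b i) / 2 ^ k)

lemma dyadicRound_zero (b x : Lat d) : dyadicRound b 0 x = x := by
  funext i
  simp [dyadicRound]

lemma dyadicRound_succ_apply (b : Lat d) (k : ℕ) (x : Lat d) (i : Fin d) :
    dyadicRound b (k + 1) x i = b i + 2 ^ k * (2 * ((x i - b i) / 2 ^ k / 2)) := by
  simp only [dyadicRound]
  rw [Int.ediv_ediv_of_nonneg (by positivity), ← pow_succ]
  ring

/-- Each link of the chain depends only on its finer endpoint, so the links of level k are counted
by the points of level k. -/
lemma dyadicRound_succ_dyadicRound (b : Lat d) (k : ℕ) (x : Lat d) :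
    dyadicRound b (k + 1) (dyadicRound b k x) = dyadicRound b (k + 1) x := by
  funext i
  rw [dyadicRound_succ_apply, dyadicRound_succ_apply]
  simp [dyadicRound]

lemma norm_dyadicRound_sub_le (b : Lat d) (k : ℕ) (x : Lat d) :
    ‖dyadicRound b (k + 1) x - dyadicRound b k x‖ ≤ 2 ^ k := by
  refine (pi_norm_le_iff_of_nonneg (by positivity)).2 fun i => ?_
  rw [Pi.sub_apply, dyadicRound_succ_apply, Int.norm_eq_abs, ← Int.cast_abs]
  have h1 : b i + 2 ^ k * (2 * ((x i - b i) / 2 ^ k / 2)) - dyadicRound b k x i =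
      2 ^ k * (2 * ((x i - b i) / 2 ^ k / 2) - (x i - b i) / 2 ^ k) := by
    simp only [dyadicRound]; ring
  rw [h1, abs_mul, abs_of_nonneg (by positivity)]
  have h2 : |2 * ((x i - b i) / 2 ^ k / 2) - (x i - b i) / 2 ^ k| ≤ 1 := by
    generalize (x i - b i) / 2 ^ k = t
    rw [abs_le]; omega
  have h3 : (2 : ℤ) ^ k * |2 * ((x i - b i) / 2 ^ k / 2) - (x i - b i) / 2 ^ k| ≤ 2 ^ k * 1 := by
    gcongr
  rw [mul_one] at h3
  exact_mod_cast h3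

lemma dyadicRound_mem_cube {b x : Lat d} {N : ℤ} (hx : x ∈ cube b 0 N) (k : ℕ) :
    dyadicRound b k x ∈ cube b 0 N := by
  rw [mem_cube] at hx ⊢
  intro i
  have h0 := hx i
  have h1 : 0 ≤ (x i - b i) / 2 ^ k := Int.ediv_nonneg (by omega) (by positivity)
  have h2 : 2 ^ k * ((x i - b i) / 2 ^ k) ≤ x i - b i := Int.mul_ediv_self_le (by positivity)
  have h3 : (0:ℤ) ≤ 2 ^ k * ((x i - b i) / 2 ^ k) := by positivity
  simp only [dyadicRound]
  omega

lemma dyadicRound_eq_base {b x : Lat d} {m : ℕ} {N : ℤ} (hN : N ≤ 2 ^ m) (hx : x ∈ cube b 0 N) :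
    dyadicRound b m x = b := by
  rw [mem_cube] at hx
  funext i
  have h0 := hx i
  simp only [dyadicRound]
  rw [Int.ediv_eq_zero_of_lt (by omega) (by omega)]
  simp

lemma card_image_dyadicRound_le {b : Lat d} {m k : ℕ} {N : ℤ} (hN : N ≤ 2 ^ m) (hk : k ≤ m) :
    ((cube b 0 N).image (dyadicRound b k)).card ≤ (2 ^ (m - k)) ^ d := by
  have hsub : (cube b 0 N).image (dyadicRound b k) ⊆
      (Fintype.piFinset fun _ : Fin d => Finset.Ico (0 : ℤ) (2 ^ (m - k))).image
        fun t i => b i + 2 ^ k * t i := by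
    intro y hy
    obtain ⟨x, hx, rfl⟩ := Finset.mem_image.1 hy
    rw [mem_cube] at hx
    refine Finset.mem_image.2 ⟨fun i => (x i - b i) / 2 ^ k, ?_, rfl⟩
    rw [Fintype.mem_piFinset]
    intro i
    have h0 := hx i
    rw [Finset.mem_Ico]
    refine ⟨Int.ediv_nonneg (by omega) (by positivity), ?_⟩
    rw [Int.ediv_lt_iff_lt_mul (by positivity), ← pow_add, Nat.sub_add_cancel hk]
    omega
  refine (Finset.card_le_card hsub).trans (Finset.card_image_le.trans ?_)
  have h2 : ((2 : ℤ) ^ (m - k)).toNat = 2 ^ (m - k) := by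
    rw [show (2 : ℤ) ^ (m - k) = ((2 ^ (m - k) : ℕ) : ℤ) by push_cast; rfl, Int.toNat_natCast]
  simp [h2]

lemma exists_sum_sqrt_two_pow_le (d : ℕ) (E : ℝ) (hE : 0 ≤ E) : ∃ C : ℝ, 0 < C ∧ ∀ m : ℕ,
    ∑ k ∈ Finset.range m, √2 ^ k * ((d : ℝ) * (m - k : ℕ) + E) ≤ C * √2 ^ m := by
  have h2 : 0 < √2 := by positivity
  have h1 : 1 < √2 := by
    rw [Real.lt_sqrt] <;> norm_num
  set r := (√2)⁻¹ with hr
  have hr1 : ‖r‖ < 1 := by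
    rw [Real.norm_of_nonneg (by positivity)]
    exact inv_lt_one_of_one_lt₀ h1
  have hs : Summable fun j : ℕ => r ^ j * ((d : ℝ) * j + E) := by
    have a1 := (summable_pow_mul_geometric_of_norm_lt_one 1 hr1).mul_left (d : ℝ)
    have a2 := (summable_geometric_of_norm_lt_one hr1).mul_left E
    refine (a1.add a2).congr fun j => ?_
    ring
  have hs0 : ∀ j : ℕ, 0 ≤ r ^ j * ((d : ℝ) * j + E) := fun j => by positivity
  have ht0 : 0 ≤ ∑' j : ℕ, r ^ j * ((d : ℝ) * j + E) := tsum_nonneg hs0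
  refine ⟨1 + ∑' j : ℕ, r ^ j * ((d : ℝ) * j + E), by linarith, fun m => ?_⟩
  calc ∑ k ∈ Finset.range m, √2 ^ k * ((d : ℝ) * (m - k : ℕ) + E)
      = ∑ j ∈ Finset.range m, √2 ^ m * (r ^ (j + 1) * ((d : ℝ) * (j + 1 : ℕ) + E)) := by
        rw [← Finset.sum_range_reflect]
        refine Finset.sum_congr rfl fun j hj => ?_
        have hj' := Finset.mem_range.1 hj
        have e1 : m - (m - 1 - j) = j + 1 := by omega
        have e2 : √2 ^ m = √2 ^ (m - 1 - j) * √2 ^ (j + 1) := by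
          rw [← pow_add]; congr 1; omega
        rw [e1, e2, hr, ← mul_assoc, mul_assoc (√2 ^ (m - 1 - j)), ← mul_pow,
          mul_inv_cancel₀ h2.ne', one_pow, mul_one]
    _ = √2 ^ m * ∑ j ∈ Finset.range m, r ^ (j + 1) * ((d : ℝ) * (j + 1 : ℕ) + E) := by
        rw [Finset.mul_sum]
    _ ≤ √2 ^ m * (1 + ∑' j : ℕ, r ^ j * ((d : ℝ) * j + E)) := by
        refine mul_le_mul_of_nonneg_left ?_ (by positivity)
        have h3 := hs.sum_le_tsum (Finset.range (m + 1)) fun j _ => hs0 j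
        rw [Finset.sum_range_succ'] at h3
        have h4 := hs0 0
        linarith
    _ = _ := mul_comm _ _

/-- A chaining bound: increments with exponential moments controlled by the square root of the
distance have a one-sided supremum of order `√(A N)` on a cube of side length `N`. -/
lemma exists_chaining_bound (d : ℕ) (E : ℝ) (hE : 0 ≤ E) : ∃ C : ℝ, 0 < C ∧
    ∀ (Ω : Type*) [MeasurableSpace Ω] (P : Measure Ω) [IsProbabilityMeasure P]
      (X : Lat d → Ω → ℝ) (b : Lat d) (N : ℕ) (A : ℝ), 1 ≤ N → 0 < A →
      (∀ x ∈ cube b 0 N, ∀ y ∈ cube b 0 N, ∀ r : ℝ, 0 < r → A * ‖x - y‖ ≤ r ^ 2 →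
        Integrable (fun ω => Real.exp ((X x ω - X y ω) / r)) P ∧
          ∫ ω, Real.exp ((X x ω - X y ω) / r) ∂P ≤ E) →
      ∃ R : Ω → ℝ, Integrable R P ∧ (∀ x ∈ cube b 0 N, ∀ ω, X b ω - X x ω ≤ R ω) ∧
        ∫ ω, R ω ∂P ≤ C * √(A * N) := by
  obtain ⟨C, hC, hsum⟩ := exists_sum_sqrt_two_pow_le d E hE
  refine ⟨C * √2, by positivity, fun Ω _ P _ X b N A hN hA h => ?_⟩
  obtain ⟨n, hn1, hn2⟩ := exists_nat_pow_near hN (by norm_num : 1 < 2)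
  set m := n + 1 with hm
  have hNm : (N : ℤ) ≤ 2 ^ m := by exact_mod_cast hn2.le
  -- Links of level k have length at most 2^k, and r_k² = A·2^k is the scale on which their
  -- exponential moments are controlled.
  set r : ℕ → ℝ := fun k => √A * √2 ^ k with hr
  have hr0 : ∀ k, 0 < r k := fun k => by positivity
  have hr2 : ∀ k, r k ^ 2 = A * 2 ^ k := fun k => by
    simp only [hr]
    rw [mul_pow, Real.sq_sqrt hA.le, ← pow_mul, mul_comm k, pow_mul, Real.sq_sqrt (by norm_num)]
  -- There are at most 2^(d(m-k)) ≤ exp(a_k) links of level k, so the factor exp(-a_k) pays for the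
  -- union over them.
  set a : ℕ → ℝ := fun k => (d : ℝ) * (m - k : ℕ) with ha
  set S : ℕ → Finset (Lat d) := fun k => (cube b 0 N).image (dyadicRound b k) with hS
  have hSD : ∀ k, ∀ y ∈ S k, y ∈ cube b 0 (N : ℤ) := fun k y hy => by
    obtain ⟨x, hx, rfl⟩ := Finset.mem_image.1 hy
    exact dyadicRound_mem_cube hx k
  set Y : ℕ → Lat d → Ω → ℝ := fun k y ω =>
    Real.exp ((X (dyadicRound b (k + 1) y) ω - X y ω) / r k) with hY
  have hlink : ∀ k, ∀ y ∈ S k, Integrable (Y k y) P ∧ ∫ ω, Y k y ω ∂P ≤ E := by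
    intro k y hy
    refine h _ (dyadicRound_mem_cube (hSD k y hy) _) _ (hSD k y hy) (r k) (hr0 k) ?_
    rw [hr2]
    obtain ⟨x, hx, rfl⟩ := Finset.mem_image.1 hy
    rw [dyadicRound_succ_dyadicRound]
    exact mul_le_mul_of_nonneg_left (norm_dyadicRound_sub_le b k x) hA.le
  have hint : ∀ k, Integrable (fun ω => ∑ y ∈ S k, Y k y ω * Real.exp (-a k)) P := fun k =>
    integrable_finsetSum _ fun y hy => (hlink k y hy).1.mul_const _
  have hint' : ∀ k, Integrable
      (fun ω => r k * (a k + ∑ y ∈ S k, Y k y ω * Real.exp (-a k))) P := fun k =>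
    ((integrable_const _).add (hint k)).const_mul _
  refine ⟨fun ω => ∑ k ∈ Finset.range m, r k * (a k + ∑ y ∈ S k, Y k y ω * Real.exp (-a k)),
    integrable_finsetSum _ fun k _ => hint' k, ?_, ?_⟩
  · intro x hx ω
    have htel : X b ω - X x ω = ∑ k ∈ Finset.range m,
        (X (dyadicRound b (k + 1) x) ω - X (dyadicRound b k x) ω) := by
      rw [Finset.sum_range_sub (fun k => X (dyadicRound b k x) ω), dyadicRound_zero,
        dyadicRound_eq_base hNm hx]
    rw [htel]
    refine Finset.sum_le_sum fun k _ => ?_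
    have hy : dyadicRound b k x ∈ S k := Finset.mem_image_of_mem _ hx
    have h1 := Finset.single_le_sum (f := fun y => Y k y ω * Real.exp (-a k))
      (fun y _ => by positivity) hy
    simp only [hY] at h1
    rw [dyadicRound_succ_dyadicRound, ← Real.exp_add] at h1
    rw [← div_le_iff₀' (hr0 k)]
    -- The inequality u + 1 ≤ exp u at u = increment/r_k - a_k bounds each link by one term of a sum
    -- over all links; this avoids the expectation of a maximum.
    have h2 := Real.add_one_le_exp
      ((X (dyadicRound b (k + 1) x) ω - X (dyadicRound b k x) ω) / r k + -a k)
    simp only [hY]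
    linarith
  · rw [integral_finsetSum _ fun k _ => hint' k]
    have hk : ∀ k ∈ Finset.range m,
        ∫ ω, r k * (a k + ∑ y ∈ S k, Y k y ω * Real.exp (-a k)) ∂P ≤ r k * (a k + E) := by
      intro k hk
      rw [integral_const_mul, integral_add (integrable_const _) (hint k), integral_const,
        integral_finsetSum _ fun y hy => (hlink k y hy).1.mul_const _]
      simp only [probReal_univ, one_smul]
      refine mul_le_mul_of_nonneg_left (add_le_add le_rfl ?_) (hr0 k).le
      calc ∑ y ∈ S k, ∫ ω, Y k y ω * Real.exp (-a k) ∂P ≤ ∑ _y ∈ S k, E * Real.exp (-a k) := by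
            refine Finset.sum_le_sum fun y hy => ?_
            rw [integral_mul_const]
            exact mul_le_mul_of_nonneg_right (hlink k y hy).2 (Real.exp_nonneg _)
        _ = (S k).card * (E * Real.exp (-a k)) := by simp
        _ ≤ Real.exp (a k) * (E * Real.exp (-a k)) := by
            refine mul_le_mul_of_nonneg_right ?_ (by positivity)
            have hcard := card_image_dyadicRound_le (b := b) hNm (Finset.mem_range.1 hk).le
            calc ((S k).card : ℝ) ≤ (2 ^ (m - k)) ^ d := by exact_mod_cast hcard
              _ ≤ (Real.exp 1 ^ (m - k)) ^ d := by
                  gcongr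
                  linarith [Real.add_one_le_exp 1]
              _ = Real.exp (a k) := by
                  rw [← pow_mul, ← Real.exp_nat_mul]
                  congr 1
                  simp only [ha]
                  push_cast
                  ring
        _ = E := by
            rw [mul_left_comm, ← Real.exp_add]
            simp
    refine (Finset.sum_le_sum hk).trans ?_
    have e1 : ∑ k ∈ Finset.range m, r k * (a k + E) =
        √A * ∑ k ∈ Finset.range m, √2 ^ k * ((d : ℝ) * (m - k : ℕ) + E) := by
      rw [Finset.mul_sum]
      exact Finset.sum_congr rfl fun k _ => by simp only [hr, ha]; ring
    rw [e1]
    have e2 : √2 ^ m ≤ √2 * √N := by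
      rw [hm, pow_succ, mul_comm]
      refine mul_le_mul_of_nonneg_left ?_ (by positivity)
      refine Real.le_sqrt_of_sq_le ?_
      rw [← pow_mul, mul_comm n, pow_mul, Real.sq_sqrt (by norm_num)]
      exact_mod_cast hn1
    calc √A * ∑ k ∈ Finset.range m, √2 ^ k * ((d : ℝ) * (m - k : ℕ) + E)
        ≤ √A * (C * (√2 * √N)) := by
          refine mul_le_mul_of_nonneg_left ((hsum m).trans ?_) (by positivity)
          gcongr
      _ = C * √2 * √(A * N) := by
          rw [Real.sqrt_mul hA.le]; ring

/-! ### Harmonic averages of the Gaussian free field -/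

/-- The Gaussian moment generating function at 1/r is exp(var/(2r²)), whose exponent is at most 1.
-/
lemma integral_exp_div_le {Ω : Type*} [MeasurableSpace Ω] {P : Measure Ω} {X : Ω → ℝ}
    (hX : HasGaussianLaw X P) (h0 : ∫ ω, X ω ∂P = 0) {r : ℝ} (hr : 0 < r)
    (hvar : ∫ ω, X ω ^ 2 ∂P ≤ r ^ 2) :
    Integrable (fun ω => Real.exp (X ω / r)) P ∧ ∫ ω, Real.exp (X ω / r) ∂P ≤ Real.exp 1 := by
  have := hX.isProbabilityMeasure
  have hmgf := mgf_gaussianReal hX.map_eq_gaussianReal (1 / r)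
  have he : (fun ω => Real.exp (1 / r * X ω)) = fun ω => Real.exp (X ω / r) := by
    funext ω
    congr 1
    ring
  rw [mgf, he] at hmgf
  constructor
  -- A non-integrable exponential would have integral 0 by convention, contradicting the positive
  -- formula.
  · by_contra hn
    rw [integral_undef hn] at hmgf
    exact (Real.exp_pos _).ne hmgf
  · rw [hmgf, Real.exp_le_exp, h0, zero_mul, zero_add, variance_of_integral_eq_zero hX.aemeasurable h0,
      Real.coe_toNNReal _ (integral_nonneg fun ω => sq_nonneg _), one_div, inv_pow, ← div_eq_mul_inv,
      div_div, div_le_one (by positivity)]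
    nlinarith [sq_nonneg r]

section Field

variable [NeZero d] {Ω : Type*} [MeasurableSpace Ω] {P : Measure Ω} {φ : Lat d → Ω → ℝ}

lemma IsGaussianFreeField.memLp (hφ : IsGaussianFreeField φ P) (x : Lat d) : MemLp (φ x) 2 P :=
  (hφ.isGaussianProcess.hasGaussianLaw_eval x).memLp_two

lemma IsGaussianFreeField.hasGaussianLaw_sum (hφ : IsGaussianFreeField φ P) (S : Finset (Lat d))
    (a : Lat d → ℝ) : HasGaussianLaw (fun ω => ∑ y ∈ S, a y * φ y ω) P :=
  (hφ.isGaussianProcess.smul a).hasGaussianLaw_fun_sum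

lemma IsGaussianFreeField.integral_sum (hφ : IsGaussianFreeField φ P) (S : Finset (Lat d))
    (a : Lat d → ℝ) : ∫ ω, ∑ y ∈ S, a y * φ y ω ∂P = 0 := by
  rw [integral_finsetSum _ fun y _ =>
    (hφ.isGaussianProcess.hasGaussianLaw_eval y).integrable.const_mul (a y)]
  exact Finset.sum_eq_zero fun y _ => by rw [integral_const_mul, hφ.centered, mul_zero]

lemma IsGaussianFreeField.integral_sum_mul_sum (hφ : IsGaussianFreeField φ P)
    (S T : Finset (Lat d)) (a b : Lat d → ℝ) :
    ∫ ω, (∑ y ∈ S, a y * φ y ω) * (∑ z ∈ T, b z * φ z ω) ∂P =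
      ∑ y ∈ S, a y * ∑ z ∈ T, b z * green y z := by
  have hint : ∀ y z, Integrable (fun ω => a y * φ y ω * (b z * φ z ω)) P := fun y z => by
    have := (hφ.memLp y).integrable_mul (hφ.memLp z)
    refine (this.const_mul (a y * b z)).congr (ae_of_all _ fun ω => ?_)
    simp only [Pi.mul_apply]
    ring
  simp only [Finset.sum_mul_sum]
  rw [integral_finsetSum _ fun y _ => integrable_finsetSum _ fun z _ => hint y z]
  refine Finset.sum_congr rfl fun y _ => ?_
  rw [integral_finsetSum _ fun z _ => hint y z, Finset.mul_sum]
  refine Finset.sum_congr rfl fun z _ => ?_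
  rw [← hφ.covariance, ← integral_const_mul, ← integral_const_mul]
  congr 1
  funext ω
  ring

lemma IsGaussianFreeField.hasGaussianLaw_harmonicAverage (hφ : IsGaussianFreeField φ P)
    (hd : 3 ≤ d) {U : Finset (Lat d)} {x : Lat d} (hx : x ∈ U) :
    HasGaussianLaw (fun ω => harmonicAverage U (fun y => φ y ω) x) P := by
  simp only [harmonicAverage_eq_sum hd hx]
  exact hφ.hasGaussianLaw_sum _ _

lemma IsGaussianFreeField.integral_harmonicAverage (hφ : IsGaussianFreeField φ P)
    (hd : 3 ≤ d) {U : Finset (Lat d)} {x : Lat d} (hx : x ∈ U) :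
    ∫ ω, harmonicAverage U (fun y => φ y ω) x ∂P = 0 := by
  simp only [harmonicAverage_eq_sum hd hx]
  exact hφ.integral_sum _ _

/-- For y in the boundary of U, g(y,·) is harmonic in V, so averaging over the exit from V gives
g(y,v). Then g(·,v) is harmonic in U, as v lies outside U. -/
lemma IsGaussianFreeField.covariance_of_disjoint (hφ : IsGaussianFreeField φ P) (hd : 3 ≤ d)
    {U V : Finset (Lat d)} {x v : Lat d} (hx : x ∈ U) (hv : v ∈ V) (hvU : v ∉ U)
    (hUV : ∀ y ∈ outerBoundary U, y ∉ V) :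
    ∫ ω, harmonicAverage U (fun y => φ y ω) x * harmonicAverage V (fun y => φ y ω) v ∂P =
      green x v := by
  simp only [harmonicAverage_eq_sum hd hx, harmonicAverage_eq_sum hd hv]
  rw [hφ.integral_sum_mul_sum]
  rw [Finset.sum_congr rfl fun y hy => by rw [sum_exitProb_mul_green hd hv (hUV y hy), green_comm]]
  rw [sum_exitProb_mul_green hd hx hvU, green_comm]

/-- Only one of the two exit averages collapses: g(·,v) has its pole inside U. -/
lemma IsGaussianFreeField.covariance_same (hφ : IsGaussianFreeField φ P) (hd : 3 ≤ d)
    {U : Finset (Lat d)} {x v : Lat d} (hx : x ∈ U) (hv : v ∈ U) :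
    ∫ ω, harmonicAverage U (fun y => φ y ω) x * harmonicAverage U (fun y => φ y ω) v ∂P =
      ∑ y ∈ outerBoundary U, exitProb U x y * green y v := by
  simp only [harmonicAverage_eq_sum hd hx, harmonicAverage_eq_sum hd hv]
  rw [hφ.integral_sum_mul_sum]
  exact Finset.sum_congr rfl fun y hy => by
    rw [sum_exitProb_mul_green hd hv (notMem_of_mem_outerBoundary hy)]

lemma sum_exitProb_mul_le (hd : 3 ≤ d) {U : Finset (Lat d)} {x : Lat d} (hx : x ∈ U)
    {f : Lat d → ℝ} {M : ℝ} (hf : ∀ y ∉ U, f y ≤ M) :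
    ∑ y ∈ outerBoundary U, exitProb U x y * f y ≤ M := by
  calc _ ≤ ∑ y ∈ outerBoundary U, exitProb U x y * M := Finset.sum_le_sum fun y hy =>
        mul_le_mul_of_nonneg_left (hf y (notMem_of_mem_outerBoundary hy)) (exitProb_nonneg _ _ _)
    _ = M := by rw [← Finset.sum_mul, sum_exitProb hd hx, one_mul]

lemma IsGaussianFreeField.integral_sq_harmonicAverage_le (hφ : IsGaussianFreeField φ P)
    (hd : 3 ≤ d) {U : Finset (Lat d)} {x : Lat d} (hx : x ∈ U) {M : ℝ}
    (hM : ∀ y ∉ U, green y x ≤ M) :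
    ∫ ω, harmonicAverage U (fun y => φ y ω) x * harmonicAverage U (fun y => φ y ω) x ∂P ≤ M := by
  rw [hφ.covariance_same hd hx hx]
  exact sum_exitProb_mul_le hd hx hM

lemma IsGaussianFreeField.hasGaussianLaw_harmonicAverage_sub (hφ : IsGaussianFreeField φ P)
    (hd : 3 ≤ d) {U : Finset (Lat d)} {x v : Lat d} (hx : x ∈ U) (hv : v ∈ U) :
    HasGaussianLaw (fun ω => harmonicAverage U (fun y => φ y ω) x -
      harmonicAverage U (fun y => φ y ω) v) P := by
  simp only [harmonicAverage_eq_sum hd hx, harmonicAverage_eq_sum hd hv,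
    ← Finset.sum_sub_distrib, ← sub_mul]
  exact hφ.hasGaussianLaw_sum _ _

/-- With D(y) = g(y,x) - g(y,v), the second moment equals E_x[D(X_T)] - E_v[D(X_T)]. Each term is at
most M in absolute value, so only first differences of g enter. -/
lemma IsGaussianFreeField.integral_sq_harmonicAverage_sub_le (hφ : IsGaussianFreeField φ P)
    (hd : 3 ≤ d) {U : Finset (Lat d)} {x v : Lat d} (hx : x ∈ U) (hv : v ∈ U) {M : ℝ}
    (hM : ∀ y ∉ U, |green y x - green y v| ≤ M) :
    ∫ ω, (harmonicAverage U (fun y => φ y ω) x - harmonicAverage U (fun y => φ y ω) v) ^ 2 ∂P ≤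
      2 * M := by
  set H : Lat d → Ω → ℝ := fun x ω => harmonicAverage U (fun y => φ y ω) x with hH
  have hint : ∀ {x v}, x ∈ U → v ∈ U → Integrable (fun ω => H x ω * H v ω) P := fun hx hv =>
    (hφ.hasGaussianLaw_harmonicAverage hd hx).memLp_two.integrable_mul
      (hφ.hasGaussianLaw_harmonicAverage hd hv).memLp_two
  have e : ∫ ω, (H x ω - H v ω) ^ 2 ∂P =
      (∫ ω, H x ω * H x ω ∂P - ∫ ω, H x ω * H v ω ∂P) +
        (∫ ω, H v ω * H v ω ∂P - ∫ ω, H v ω * H x ω ∂P) := by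
    have i1 : Integrable (fun ω => H x ω * H x ω - H x ω * H v ω) P := (hint hx hx).sub (hint hx hv)
    have i2 : Integrable (fun ω => H v ω * H v ω - H v ω * H x ω) P := (hint hv hv).sub (hint hv hx)
    rw [← integral_sub (hint hx hx) (hint hx hv), ← integral_sub (hint hv hv) (hint hv hx),
      ← integral_add i1 i2]
    congr 1
    funext ω
    ring
  change ∫ ω, (H x ω - H v ω) ^ 2 ∂P ≤ 2 * M
  rw [e, hφ.covariance_same hd hx hx, hφ.covariance_same hd hx hv, hφ.covariance_same hd hv hv,
    hφ.covariance_same hd hv hx, ← Finset.sum_sub_distrib, ← Finset.sum_sub_distrib, two_mul]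
  simp only [← mul_sub]
  refine add_le_add (sum_exitProb_mul_le hd hx fun y hy => (le_abs_self _).trans (hM y hy))
    (sum_exitProb_mul_le hd hv fun y hy => ?_)
  rw [← neg_sub]
  exact (neg_le_abs _).trans (hM y hy)

end Field

/-! ### Geometry of the boxes -/

lemma hundred_mul_le {L K : ℕ} (hK : 100 ≤ K) : (100 * L : ℤ) ≤ K * L := by
  have : (100 : ℤ) ≤ K := by exact_mod_cast hK
  exact mul_le_mul_of_nonneg_right this (by positivity)

lemma boxB_subset_boxD (L : ℕ) (z : Lat d) : boxB L z ⊆ boxD L z := by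
  intro x hx
  simp only [boxB, boxD, mem_cube] at hx ⊢
  intro i
  have := hx i
  omega

lemma boxD_subset_boxU {L K : ℕ} (hL : 1 ≤ L) (hK : 100 ≤ K) (z : Lat d) :
    boxD L z ⊆ boxU L K z := by
  intro x hx
  simp only [boxU, boxD, mem_cube] at hx ⊢
  intro i
  have := hx i
  have h1 := hundred_mul_le (L := L) hK
  generalize (K * L : ℤ) = T at *
  omega

lemma le_norm_of_le_abs {u : Lat d} {a : ℝ} {T : ℤ} (haT : a ≤ T) {i : Fin d} (h : T ≤ |u i|) :
    a ≤ ‖u‖ := by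
  refine haT.trans (le_trans ?_ (norm_le_pi_norm u i))
  rw [Int.norm_eq_abs, ← Int.cast_abs]
  exact_mod_cast h

lemma norm_le_of_abs_le {u : Lat d} {a : ℝ} {T : ℤ} (haT : T ≤ a) (hT : 0 ≤ T)
    (h : ∀ i, |u i| ≤ T) : ‖u‖ ≤ a := by
  have hT' : (0 : ℝ) ≤ T := by exact_mod_cast hT
  refine (pi_norm_le_iff_of_nonneg (hT'.trans haT)).2 fun i => ?_
  rw [Int.norm_eq_abs, ← Int.cast_abs]
  refine le_trans ?_ haT
  exact_mod_cast h i

lemma norm_sub_ge_of_notMem_boxU {L K : ℕ} (hK : 100 ≤ K) {x y z : Lat d}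
    (hx : x ∈ boxD L z) (hy : y ∉ boxU L K z) : (K : ℝ) * L / 2 ≤ ‖y - x‖ := by
  simp only [boxU, boxD, mem_cube, not_forall] at hx hy
  obtain ⟨i, hi⟩ := hy
  have hxi := hx i
  have h1 := hundred_mul_le (L := L) hK
  have h2 : ((100 * L : ℤ) : ℝ) ≤ ((K * L : ℤ) : ℝ) := by exact_mod_cast h1
  refine le_norm_of_le_abs (T := K * L - 3 * L) (i := i) ?_ ?_
  · push_cast at h2 ⊢
    have : (0 : ℝ) ≤ L := by positivity
    linarith
  · rw [Pi.sub_apply, le_abs]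
    generalize (K * L : ℤ) = T at *
    omega

lemma uIcc_subset_boxD {L : ℕ} {x y z : Lat d} (hx : x ∈ boxD L z) (hy : y ∈ boxD L z) :
    ∀ u ∈ Set.uIcc x y, u ∈ boxD L z := by
  intro u hu
  rw [← Set.pi_univ_uIcc] at hu
  simp only [boxD, mem_cube] at hx hy ⊢
  intro i
  have h1 : (x i ≤ u i ∧ u i ≤ y i) ∨ (y i ≤ u i ∧ u i ≤ x i) :=
    Set.mem_uIcc.1 (hu i (Set.mem_univ i))
  have := hx i
  have := hy i
  omega

lemma norm_sub_le_of_mem_uIcc {x y u : Lat d} (hu : u ∈ Set.uIcc x y) : ‖x - u‖ ≤ ‖x - y‖ := by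
  rw [← Set.pi_univ_uIcc] at hu
  refine (pi_norm_le_iff_of_nonneg (norm_nonneg _)).2 fun i => ?_
  refine le_trans ?_ (norm_le_pi_norm (x - y) i)
  rw [Int.norm_eq_abs, Int.norm_eq_abs, ← Int.cast_abs, ← Int.cast_abs]
  have h1 : (x i ≤ u i ∧ u i ≤ y i) ∨ (y i ≤ u i ∧ u i ≤ x i) :=
    Set.mem_uIcc.1 (hu i (Set.mem_univ i))
  simp only [Pi.sub_apply]
  have : |x i - u i| ≤ |x i - y i| := by
    rcases h1 with h | h
    · rw [abs_of_nonpos (by omega), abs_of_nonpos (by omega)]; omega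
    · rw [abs_of_nonneg (by omega), abs_of_nonneg (by omega)]; omega
  exact_mod_cast this

lemma IsWellSeparated.exists_coord [NeZero d] {L K : ℕ} {𝒞 : Finset (Lat d)}
    (h : IsWellSeparated L K 𝒞) {z z' : Lat d} (hz : z ∈ 𝒞) (hz' : z' ∈ 𝒞) (hne : z ≠ z') :
    ∃ i, (L + 2 * (K * L) : ℤ) ≤ |z i - z' i| := by
  have hs := h.separated z hz z' hz' hne
  by_contra! hlt
  have h1 : ‖z - z'‖ < L + 2 * K * L := by
    have : Nonempty (Fin d) := ⟨⟨0, NeZero.pos d⟩⟩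
    refine (pi_norm_lt_iff (lt_of_le_of_ne (by positivity) fun h0 => ?_)).2 fun i => ?_
    · have h0' : (L + 2 * (K * L) : ℤ) = 0 := by
        have : ((L + 2 * (K * L) : ℤ) : ℝ) = 0 := by push_cast; linarith
        exact_mod_cast this
      have := hlt ⟨0, NeZero.pos d⟩
      rw [h0'] at this
      exact absurd this (not_lt.2 (abs_nonneg _))
    · rw [Int.norm_eq_abs, ← Int.cast_abs, Pi.sub_apply]
      have : ((|z i - z' i| : ℤ) : ℝ) < ((L + 2 * (K * L) : ℤ) : ℝ) := by exact_mod_cast hlt i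
      push_cast at this ⊢
      linarith
  exact absurd hs (not_le.2 h1)

lemma notMem_boxU_of_mem_boxU [NeZero d] {L K : ℕ} {𝒞 : Finset (Lat d)}
    (h : IsWellSeparated L K 𝒞) {z z' : Lat d} (hz : z ∈ 𝒞) (hz' : z' ∈ 𝒞) (hne : z ≠ z')
    {y : Lat d} (hy : y ∈ boxU L K z) : y ∉ boxU L K z' := by
  obtain ⟨i, hi⟩ := h.exists_coord hz hz' hne
  intro hy'
  simp only [boxU, mem_cube] at hy hy'
  have h1 := hy i
  have h2 := hy' i
  rw [le_abs] at hi
  have h3 : (0 : ℤ) ≤ K * L := by positivity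
  generalize (K * L : ℤ) = T at *
  omega

/-- The shrinking by one in the definition of U_z leaves room for the extra step out of the box. -/
lemma notMem_boxU_of_mem_outerBoundary [NeZero d] {L K : ℕ} {𝒞 : Finset (Lat d)}
    (h : IsWellSeparated L K 𝒞) {z z' : Lat d} (hz : z ∈ 𝒞) (hz' : z' ∈ 𝒞) (hne : z ≠ z')
    {y : Lat d} (hy : y ∈ outerBoundary (boxU L K z)) : y ∉ boxU L K z' := by
  obtain ⟨i, hi⟩ := h.exists_coord hz hz' hne
  intro hy'
  obtain ⟨u, hu, hs⟩ := Finset.mem_biUnion.1 (Finset.mem_sdiff.1 hy).1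
  obtain ⟨⟨j, b⟩, -, rfl⟩ := Finset.mem_image.1 hs
  simp only [boxU, mem_cube] at hu hy'
  have h1 := hu i
  have h2 := hy' i
  have h4 : |unitStep (j, b) i| ≤ 1 := by
    by_cases hij : i = j
    · subst hij; cases b <;> simp [unitStep]
    · simp [unitStep, hij]
  rw [Pi.add_apply] at h2
  rw [abs_le] at h4
  rw [le_abs] at hi
  have h3 : (0 : ℤ) ≤ K * L := by positivity
  generalize (K * L : ℤ) = T at *
  omega

lemma le_norm_sub_of_mem_boxB [NeZero d] {L K : ℕ} {𝒞 : Finset (Lat d)}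
    (h : IsWellSeparated L K 𝒞) {z z' : Lat d} (hz : z ∈ 𝒞) (hz' : z' ∈ 𝒞) (hne : z ≠ z')
    {x x' : Lat d} (hx : x ∈ boxB L z) (hx' : x' ∈ boxB L z') : (K : ℝ) * L ≤ ‖x - x'‖ := by
  obtain ⟨i, hi⟩ := h.exists_coord hz hz' hne
  refine le_norm_of_le_abs (T := K * L) (i := i) (by push_cast; exact le_rfl) ?_
  simp only [boxB, mem_cube] at hx hx'
  have h1 := hx i
  have h2 := hx' i
  rw [Pi.sub_apply, le_abs]
  rw [le_abs] at hi
  have h3 : (0 : ℤ) ≤ K * L := by positivity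
  generalize (K * L : ℤ) = T at *
  omega

lemma norm_sub_le_of_mem_boxB_of_mem_boxD {L : ℕ} {x y z : Lat d} (hx : x ∈ boxB L z)
    (hy : y ∈ boxD L z) : ‖x - y‖ ≤ 4 * L := by
  simp only [boxB, boxD, mem_cube] at hx hy
  refine norm_le_of_abs_le (T := 4 * L) (by push_cast; exact le_rfl) (by positivity) fun i => ?_
  have h1 := hx i
  have h2 := hy i
  rw [Pi.sub_apply, abs_le]
  omega

/-! ### Comparison of Green functions -/

/-- The difference vector moves by at most 8L while its length n is at least KL. The gradient bound
therefore gives an error of order L/n^(d-1), which is O(1/K) relative to g, of order at least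
n^(2-d). -/
lemma exists_green_ratio_le [NeZero d] (hd : 3 ≤ d) : ∃ C : ℝ, 0 < C ∧
    ∀ (L K : ℕ) (𝒞 : Finset (Lat d)), 1 ≤ L → 100 ≤ K → IsWellSeparated L K 𝒞 →
      ∀ z ∈ 𝒞, ∀ z' ∈ 𝒞, z ≠ z' → ∀ x ∈ boxB L z, ∀ x' ∈ boxB L z', ∀ y ∈ boxD L z,
        ∀ y' ∈ boxD L z', green y y' ≤ (1 + C / K) * green x x' := by
  obtain ⟨C, hC, hgrad⟩ := exists_abs_green_sub_le hd
  obtain ⟨c, hc, hlow⟩ := exists_le_green hd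
  refine ⟨C * 8 * 2 ^ (d - 1) * 2 ^ (d - 2) / c, by positivity, ?_⟩
  intro L K 𝒞 hL hK h𝒞 z hz z' hz' hne x hx x' hx' y hy y' hy'
  have hL0 : (0 : ℝ) < L := by exact_mod_cast hL
  have hK0 : (100 : ℝ) ≤ K := by exact_mod_cast hK
  have hu := le_norm_sub_of_mem_boxB h𝒞 hz hz' hne hx hx'
  have h1 := norm_sub_le_of_mem_boxB_of_mem_boxD hx hy
  have h2 := norm_sub_le_of_mem_boxB_of_mem_boxD hx' hy'
  have hlow' := hlow x x'
  rw [green_eq_sub y y', green_eq_sub x x']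
  rw [green_eq_sub x x'] at hlow'
  set u := x - x' with hud
  set v := y - y' with hvd
  have huv : ‖u - v‖ ≤ 8 * L := by
    have : u - v = (x - y) - (x' - y') := by rw [hud, hvd]; abel
    rw [this]
    linarith [norm_sub_le (x - y) (x' - y')]
  have hKL : 100 * (L : ℝ) ≤ K * L := by gcongr
  set n := ‖u‖ with hn
  have hn0 : 0 < n := by linarith
  have hn1 : 1 ≤ n := by
    have : (1 : ℝ) ≤ L := by exact_mod_cast hL
    linarith
  -- As K ≥ 100, 8L ≤ n/2, so the whole box spanned by `u` and `v` keeps distance n/2 from the pole.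
  have hg := hgrad u v (n / 2) (by positivity) fun w hw => by
    have h3 := norm_sub_le_of_mem_uIcc hw
    have h4 := norm_sub_norm_le u w
    rw [← hn] at h4
    linarith
  have hg' : green v 0 ≤ green u 0 + C * (8 * L) / (n / 2) ^ (d - 1) := by
    have h5 : C * ‖u - v‖ / (n / 2) ^ (d - 1) ≤ C * (8 * L) / (n / 2) ^ (d - 1) := by gcongr
    have h6 := neg_abs_le (green u 0 - green v 0)
    linarith
  refine hg'.trans ?_
  rw [add_mul, one_mul]
  refine add_le_add le_rfl ?_
  have hlow2 : c / (2 * n) ^ (d - 2) ≤ green u 0 := by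
    refine hlow'.trans' ?_
    gcongr
    linarith
  have e1 : (n / 2) ^ (d - 1) = n ^ (d - 2) * n / 2 ^ (d - 1) := by
    rw [div_pow, ← pow_succ]
    congr 2
    omega
  calc C * (8 * L) / (n / 2) ^ (d - 1)
      = C * 8 * 2 ^ (d - 1) / n ^ (d - 2) * (L / n) := by
        rw [e1]; field_simp
    _ ≤ C * 8 * 2 ^ (d - 1) / n ^ (d - 2) * (1 / K) := by
        refine mul_le_mul_of_nonneg_left ?_ (by positivity)
        rw [div_le_div_iff₀ hn0 (by linarith)]
        linarith
    _ = C * 8 * 2 ^ (d - 1) * 2 ^ (d - 2) / c / K * (c / (2 * n) ^ (d - 2)) := by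
        rw [mul_pow]; field_simp
    _ ≤ _ := mul_le_mul_of_nonneg_left hlow2 (by positivity)

/-- Outside U_z the Green function is O((KL)^(2-d)), against at least c L^(2-d) inside B_z; the
ratio is O(1/K) because d - 2 ≥ 1. -/
lemma exists_green_exit_le [NeZero d] (hd : 3 ≤ d) : ∃ C : ℝ, 0 < C ∧
    ∀ (L K : ℕ), 1 ≤ L → 100 ≤ K → ∀ z : Lat d, ∀ x ∈ boxB L z, ∀ x' ∈ boxB L z,
      ∀ v ∈ boxD L z, ∀ y ∉ boxU L K z, green y v ≤ C / K * green x x' := by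
  obtain ⟨C, hC, hup⟩ := exists_green_le (d := d) hd
  obtain ⟨c, hc, hlow⟩ := exists_le_green hd
  refine ⟨C * 2 ^ (d - 2) / c, by positivity, ?_⟩
  intro L K hL hK z x hx x' hx' v hv y hy
  have hL0 : (0 : ℝ) < L := by exact_mod_cast hL
  have hK0 : (100 : ℝ) ≤ K := by exact_mod_cast hK
  have h1 := norm_sub_ge_of_notMem_boxU hK hv hy
  have h2 := norm_sub_le_of_mem_cube (by omega) hx hx'
  push_cast at h2
  have hyv : y ≠ v := by
    rintro rfl
    exact hy (boxD_subset_boxU hL hK z hv)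
  have hlow' : c / (L : ℝ) ^ (d - 2) ≤ green x x' := by
    refine (hlow x x').trans' ?_
    gcongr
    linarith
  have hKpow : (K : ℝ) ≤ (K : ℝ) ^ (d - 2) := le_self_pow₀ (by linarith) (by omega)
  calc green y v ≤ C / ‖y - v‖ ^ (d - 2) := hup y v hyv
    _ ≤ C / (K * L / 2) ^ (d - 2) := by
        gcongr
    _ = C * 2 ^ (d - 2) / L ^ (d - 2) * (1 / (K : ℝ) ^ (d - 2)) := by
        rw [div_pow, mul_pow]; field_simp
    _ ≤ C * 2 ^ (d - 2) / L ^ (d - 2) * (1 / K) := by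
        gcongr
    _ = C * 2 ^ (d - 2) / c / K * (c / (L : ℝ) ^ (d - 2)) := by field_simp
    _ ≤ _ := mul_le_mul_of_nonneg_left hlow' (by positivity)

lemma exists_green_exit_sub_le [NeZero d] (hd : 3 ≤ d) : ∃ C : ℝ, 0 < C ∧
    ∀ (L K : ℕ), 1 ≤ L → 100 ≤ K → ∀ z : Lat d, ∀ x ∈ boxD L z, ∀ x' ∈ boxD L z,
      ∀ y ∉ boxU L K z, |green y x - green y x'| ≤ C / (K * L : ℝ) ^ (d - 1) * ‖x - x'‖ := by
  obtain ⟨C, hC, hgrad⟩ := exists_abs_green_sub_le hd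
  refine ⟨C * 2 ^ (d - 1), by positivity, ?_⟩
  intro L K hL hK z x hx x' hx' y hy
  have hL0 : (0 : ℝ) < L := by exact_mod_cast hL
  have hK0 : (100 : ℝ) ≤ K := by exact_mod_cast hK
  rw [green_eq_sub y x, green_eq_sub y x']
  refine (hgrad (y - x) (y - x') (K * L / 2) (by positivity) fun w hw => ?_).trans (le_of_eq ?_)
  · have hyw : y - w ∈ Set.uIcc x x' := by
      rw [← Set.pi_univ_uIcc] at hw ⊢
      intro i hi
      have := hw i hi
      rw [Set.mem_uIcc] at this ⊢
      simp only [Pi.sub_apply] at this ⊢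
      omega
    have := norm_sub_ge_of_notMem_boxU hK (uIcc_subset_boxD hx hx' _ hyw) hy
    rwa [sub_sub_cancel] at this
  · rw [sub_sub_sub_cancel_left, norm_sub_rev x' x, div_pow]
    field_simp

/-! ### Selections and the corner selection -/

lemma IsWellSeparated.boxUnion_nonempty {L K : ℕ} {𝒞 : Finset (Lat d)} (hL : 1 ≤ L)
    (h : IsWellSeparated L K 𝒞) : (boxUnion L 𝒞).Nonempty := by
  obtain ⟨z, hz⟩ := h.nonempty
  refine ⟨z, Finset.mem_biUnion.2 ⟨z, hz, ?_⟩⟩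
  rw [boxB, mem_cube]
  intro i
  omega

lemma selection_mem {L : ℕ} {𝒞 : Finset (Lat d)} {f : 𝒞 → Lat d} (hf : f ∈ selections L 𝒞)
    (z : 𝒞) : f z ∈ boxD L z.1 :=
  Fintype.mem_piFinset.1 hf z

lemma boxD_eq_cube (L : ℕ) (z : Lat d) :
    boxD L z = cube (fun i => z i - 3 * L) 0 ((7 * L : ℕ) : ℤ) := by
  ext x
  simp only [boxD, mem_cube]
  push_cast
  refine forall_congr' fun i => ?_
  omega

lemma corner_mem_boxD {L : ℕ} (hL : 1 ≤ L) (z : Lat d) :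
    (fun i => z i - 3 * L : Lat d) ∈ boxD L z := by
  simp only [boxD, mem_cube]
  intro i
  omega

lemma cornerSelection_mem {L : ℕ} (hL : 1 ≤ L) (𝒞 : Finset (Lat d)) :
    (fun (z : 𝒞) i => z.1 i - 3 * L : 𝒞 → Lat d) ∈ selections L 𝒞 :=
  Fintype.mem_piFinset.2 fun z => corner_mem_boxD hL z.1

variable [NeZero d]

/-! ### The weights -/

lemma weight_nonneg (L : ℕ) (𝒞 : Finset (Lat d)) (z : Lat d) : 0 ≤ weight L 𝒞 z :=
  Finset.sum_nonneg fun _ _ => div_nonneg (equilibrium_nonneg _ _) (capacity_nonneg _)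

lemma IsWellSeparated.pairwiseDisjoint_boxB {L K : ℕ} {𝒞 : Finset (Lat d)} (hL : 1 ≤ L)
    (hK : 100 ≤ K) (h : IsWellSeparated L K 𝒞) :
    Set.PairwiseDisjoint (𝒞 : Set (Lat d)) (boxB L) := by
  intro z hz z' hz' hne
  refine Finset.disjoint_left.2 fun x hx hx' => ?_
  exact notMem_boxU_of_mem_boxU h hz hz' hne
    (boxD_subset_boxU hL hK z (boxB_subset_boxD L z hx))
    (boxD_subset_boxU hL hK z' (boxB_subset_boxD L z' hx'))

lemma IsWellSeparated.sum_boxUnion {L K : ℕ} {𝒞 : Finset (Lat d)} (hL : 1 ≤ L)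
    (hK : 100 ≤ K) (h : IsWellSeparated L K 𝒞) (f : Lat d → ℝ) :
    ∑ x ∈ boxUnion L 𝒞, f x = ∑ z : 𝒞, ∑ x ∈ boxB L z.1, f x := by
  rw [boxUnion, Finset.sum_biUnion (h.pairwiseDisjoint_boxB hL hK), Finset.sum_coe_sort 𝒞
    fun z => ∑ x ∈ boxB L z, f x]

lemma IsWellSeparated.sum_weight (hd : 3 ≤ d) {L K : ℕ} {𝒞 : Finset (Lat d)} (hL : 1 ≤ L)
    (hK : 100 ≤ K) (h : IsWellSeparated L K 𝒞) : ∑ z : 𝒞, weight L 𝒞 z.1 = 1 := by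
  have hcap := capacity_pos hd (h.boxUnion_nonempty hL)
  unfold weight
  rw [← h.sum_boxUnion hL hK fun x => equilibrium (boxUnion L 𝒞) x / capacity (boxUnion L 𝒞),
    ← Finset.sum_div]
  exact div_self hcap.ne'

/-! ### The variance of `Zf` -/

section Field

variable {Ω : Type*} [MeasurableSpace Ω] {P : Measure Ω} {φ : Lat d → Ω → ℝ}

lemma IsGaussianFreeField.memLp_Zf (hφ : IsGaussianFreeField φ P) (hd : 3 ≤ d) {L K : ℕ}
    (hL : 1 ≤ L) (hK : 100 ≤ K) {𝒞 : Finset (Lat d)} {f : 𝒞 → Lat d}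
    (hf : f ∈ selections L 𝒞) : MemLp (Zf φ L K 𝒞 f) 2 P := by
  unfold Zf
  refine memLp_finsetSum _ fun z _ => MemLp.const_mul ?_ _
  exact (hφ.hasGaussianLaw_harmonicAverage hd
    (boxD_subset_boxU hL hK z.1 (selection_mem hf z))).memLp_two

lemma IsGaussianFreeField.integral_Zf (hφ : IsGaussianFreeField φ P) (hd : 3 ≤ d) {L K : ℕ}
    (hL : 1 ≤ L) (hK : 100 ≤ K) {𝒞 : Finset (Lat d)} {f : 𝒞 → Lat d}
    (hf : f ∈ selections L 𝒞) : ∫ ω, Zf φ L K 𝒞 f ω ∂P = 0 := by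
  have hmem : ∀ z : 𝒞, f z ∈ boxU L K z.1 := fun z =>
    boxD_subset_boxU hL hK z.1 (selection_mem hf z)
  unfold Zf
  rw [integral_finsetSum _ fun z _ =>
    (hφ.hasGaussianLaw_harmonicAverage hd (hmem z)).integrable.const_mul _]
  exact Finset.sum_eq_zero fun z _ => by
    rw [integral_const_mul, hφ.integral_harmonicAverage hd (hmem z), mul_zero]

lemma exists_integral_sq_Zf_le (hd : 3 ≤ d) : ∃ C : ℝ, 0 < C ∧
    ∀ (Ω : Type*) [MeasurableSpace Ω] (P : Measure Ω) (φ : Lat d → Ω → ℝ),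
      IsGaussianFreeField φ P → ∀ (L K : ℕ) (𝒞 : Finset (Lat d)), 1 ≤ L → 100 ≤ K →
        IsWellSeparated L K 𝒞 → ∀ f ∈ selections L 𝒞,
          (∫ ω, Zf φ L K 𝒞 f ω ^ 2 ∂P) * capacity (boxUnion L 𝒞) ≤ 1 + C / K := by
  obtain ⟨C₁, hC₁, hratio⟩ := exists_green_ratio_le (d := d) hd
  obtain ⟨C₂, hC₂, hexit⟩ := exists_green_exit_le (d := d) hd
  refine ⟨C₁ + C₂, by positivity, fun Ω _ P φ hφ L K 𝒞 hL hK h𝒞 f hf => ?_⟩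
  have hK0 : (0 : ℝ) < K := by
    have : (100 : ℝ) ≤ K := by exact_mod_cast hK
    linarith
  have hcap := capacity_pos hd (h𝒞.boxUnion_nonempty hL)
  set C := boxUnion L 𝒞 with hC
  set e : Lat d → ℝ := fun x => equilibrium C x / capacity C with he
  have he0 : ∀ x, 0 ≤ e x := fun x => div_nonneg (equilibrium_nonneg _ _) hcap.le
  have hmemD : ∀ z : 𝒞, f z ∈ boxD L z.1 := selection_mem hf
  have hmem : ∀ z : 𝒞, f z ∈ boxU L K z.1 := fun z => boxD_subset_boxU hL hK z.1 (hmemD z)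
  set H : 𝒞 → Ω → ℝ := fun z ω => harmonicAverage (boxU L K z.1) (fun y => φ y ω) (f z) with hH
  have hint : ∀ z z', Integrable (fun ω => H z ω * H z' ω) P := fun z z' =>
    (hφ.hasGaussianLaw_harmonicAverage hd (hmem z)).memLp_two.integrable_mul
      (hφ.hasGaussianLaw_harmonicAverage hd (hmem z')).memLp_two
  have hsq : ∫ ω, Zf φ L K 𝒞 f ω ^ 2 ∂P =
      ∑ z : 𝒞, ∑ z' : 𝒞, weight L 𝒞 z.1 * weight L 𝒞 z'.1 * ∫ ω, H z ω * H z' ω ∂P := by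
    have e1 : ∀ ω, Zf φ L K 𝒞 f ω ^ 2 = ∑ z : 𝒞, ∑ z' : 𝒞,
        weight L 𝒞 z.1 * weight L 𝒞 z'.1 * (H z ω * H z' ω) := fun ω => by
      rw [Zf, sq, Finset.sum_mul_sum]
      exact Finset.sum_congr rfl fun z _ => Finset.sum_congr rfl fun z' _ => by
        simp only [hH]; ring
    simp only [e1]
    rw [integral_finsetSum _ fun z _ => integrable_finsetSum _ fun z' _ => (hint z z').const_mul _]
    refine Finset.sum_congr rfl fun z _ => ?_
    rw [integral_finsetSum _ fun z' _ => (hint z z').const_mul _]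
    exact Finset.sum_congr rfl fun z' _ => integral_const_mul _ _
  -- The bound holds for every pair of points of the two boxes, although the left side does not
  -- depend on them. So it may be averaged against the equilibrium measure, turning weights into an
  -- energy.
  have hcov : ∀ z z' : 𝒞, ∀ x ∈ boxB L z.1, ∀ x' ∈ boxB L z'.1,
      ∫ ω, H z ω * H z' ω ∂P ≤ (1 + (C₁ + C₂) / K) * green x x' := by
    intro z z' x hx x' hx'
    have hg := green_nonneg x x'
    by_cases hzz : z = z'
    · subst hzz
      refine (hφ.integral_sq_harmonicAverage_le hd (hmem z)
        (hexit L K hL hK z.1 x hx x' hx' (f z) (hmemD z))).trans ?_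
      refine mul_le_mul_of_nonneg_right ?_ hg
      have : 0 ≤ C₁ / K := by positivity
      rw [add_div]
      linarith
    · have hne : z.1 ≠ z'.1 := fun h => hzz (Subtype.ext h)
      simp only [hH]
      rw [hφ.covariance_of_disjoint hd (hmem z) (hmem z')
        (notMem_boxU_of_mem_boxU h𝒞 z'.2 z.2 hne.symm (hmem z'))
        (fun y hy => notMem_boxU_of_mem_outerBoundary h𝒞 z.2 z'.2 hne hy)]
      refine (hratio L K 𝒞 hL hK h𝒞 z.1 z.2 z'.1 z'.2 hne x hx x' hx' _ (hmemD z) _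
        (hmemD z')).trans ?_
      refine mul_le_mul_of_nonneg_right ?_ hg
      have : 0 ≤ C₂ / K := by positivity
      rw [add_div]
      linarith
  have hbound : ∫ ω, Zf φ L K 𝒞 f ω ^ 2 ∂P ≤
      (1 + (C₁ + C₂) / K) * ∑ x ∈ C, ∑ x' ∈ C, e x * e x' * green x x' := by
    rw [hsq, hC, h𝒞.sum_boxUnion hL hK, Finset.mul_sum]
    refine Finset.sum_le_sum fun z _ => ?_
    simp only [h𝒞.sum_boxUnion hL hK]
    rw [Finset.sum_comm, Finset.mul_sum]
    refine Finset.sum_le_sum fun z' _ => ?_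
    have hw : ∀ z : Lat d, weight L 𝒞 z = ∑ x ∈ boxB L z, e x := fun z => rfl
    rw [hw, hw, Finset.sum_mul_sum, Finset.sum_mul, Finset.mul_sum]
    refine Finset.sum_le_sum fun x hx => ?_
    rw [Finset.sum_mul, Finset.mul_sum]
    refine Finset.sum_le_sum fun x' hx' => ?_
    have := mul_le_mul_of_nonneg_left (hcov z z' x hx x' hx') (mul_nonneg (he0 x) (he0 x'))
    linarith
  have hsum : ∑ x ∈ C, ∑ x' ∈ C, e x * e x' * green x x' = 1 / capacity C := by
    have e2 : ∀ x x', e x * e x' * green x x' =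
        equilibrium C x * equilibrium C x' * green x x' / capacity C ^ 2 := fun x x' => by
      simp only [he]; field_simp
    simp only [e2, ← Finset.sum_div]
    rw [sum_sum_equilibrium_mul_green hd]
    field_simp
  rw [hsum, mul_one_div] at hbound
  rwa [← le_div_iff₀ hcap]

/-! ### The expectation of the infimum -/

/-- Chaining with N = 7L and A of order (KL)^(1-d) gives AN = O(K^(1-d) L^(2-d)). Since d - 1 ≥ 2,
the square root carries the factor 1/K. -/
lemma exists_oscillation_bound (hd : 3 ≤ d) : ∃ C : ℝ, 0 < C ∧
    ∀ (Ω : Type*) [MeasurableSpace Ω] (P : Measure Ω) [IsProbabilityMeasure P]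
      (φ : Lat d → Ω → ℝ), IsGaussianFreeField φ P → ∀ (L K : ℕ), 1 ≤ L → 100 ≤ K →
        ∀ z : Lat d, ∃ R : Ω → ℝ, Integrable R P ∧
          (∀ x ∈ boxD L z, ∀ ω,
            harmonicAverage (boxU L K z) (fun y => φ y ω) (fun i => z i - 3 * L) -
              harmonicAverage (boxU L K z) (fun y => φ y ω) x ≤ R ω) ∧
          ∫ ω, R ω ∂P ≤ C / K * √(1 / (L : ℝ) ^ (d - 2)) := by
  obtain ⟨C₀, hC₀, hchain⟩ := exists_chaining_bound d (Real.exp 1) (Real.exp_nonneg 1)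
  obtain ⟨C₁, hC₁, hgreen⟩ := exists_green_exit_sub_le (d := d) hd
  refine ⟨C₀ * √(14 * C₁), by positivity, fun Ω _ P _ φ hφ L K hL hK z => ?_⟩
  have hL0 : (0 : ℝ) < L := by exact_mod_cast hL
  have hK0 : (100 : ℝ) ≤ K := by exact_mod_cast hK
  have hKpos : (0 : ℝ) < K := by linarith
  set A : ℝ := 2 * (C₁ / (K * L : ℝ) ^ (d - 1)) with hA
  obtain ⟨R, hR1, hR2, hR3⟩ := hchain Ω P
    (fun x ω => harmonicAverage (boxU L K z) (fun y => φ y ω) x) (fun i => z i - 3 * L) (7 * L) A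
    (by omega) (by positivity) (fun x hx y hy r hr hAr => by
      rw [← boxD_eq_cube] at hx hy
      have hxU := boxD_subset_boxU hL hK z hx
      have hyU := boxD_subset_boxU hL hK z hy
      refine integral_exp_div_le (hφ.hasGaussianLaw_harmonicAverage_sub hd hxU hyU) ?_ hr ?_
      · rw [integral_sub (hφ.hasGaussianLaw_harmonicAverage hd hxU).integrable
          (hφ.hasGaussianLaw_harmonicAverage hd hyU).integrable,
          hφ.integral_harmonicAverage hd hxU, hφ.integral_harmonicAverage hd hyU, sub_zero]
      · refine (hφ.integral_sq_harmonicAverage_sub_le hd hxU hyU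
          (hgreen L K hL hK z x hx y hy)).trans (le_trans (le_of_eq ?_) hAr)
        rw [hA]; ring)
  refine ⟨R, hR1, fun x hx ω => hR2 x (by rwa [← boxD_eq_cube]) ω, hR3.trans ?_⟩
  have e1 : A * (7 * L : ℕ) ≤ 14 * C₁ * ((1 / (K : ℝ)) ^ 2 * (1 / (L : ℝ) ^ (d - 2))) := by
    have e2 : (L : ℝ) ^ (d - 1) = L ^ (d - 2) * L := by
      rw [← pow_succ]; congr 1; omega
    have e3 : (K : ℝ) ^ 2 ≤ (K : ℝ) ^ (d - 1) := pow_le_pow_right₀ (by linarith) (by omega)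
    calc A * (7 * L : ℕ) = 14 * C₁ * (1 / (K : ℝ) ^ (d - 1) * (1 / (L : ℝ) ^ (d - 2))) := by
          rw [hA, mul_pow, e2]
          push_cast
          field_simp
          ring
      _ ≤ _ := by
          rw [one_div_pow]
          gcongr
  calc C₀ * √(A * (7 * L : ℕ))
      ≤ C₀ * √(14 * C₁ * ((1 / (K : ℝ)) ^ 2 * (1 / (L : ℝ) ^ (d - 2)))) := by gcongr
    _ = C₀ * √(14 * C₁) / K * √(1 / (L : ℝ) ^ (d - 2)) := by
        rw [Real.sqrt_mul (by positivity : 0 ≤ 14 * C₁),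
          Real.sqrt_mul (by positivity : 0 ≤ (1 / (K : ℝ)) ^ 2), Real.sqrt_sq (by positivity)]
        ring

lemma IsGaussianFreeField.integrable_Zinf [IsProbabilityMeasure P] (hφ : IsGaussianFreeField φ P)
    (hd : 3 ≤ d) {L K : ℕ} (hL : 1 ≤ L) (hK : 100 ≤ K) (𝒞 : Finset (Lat d)) :
    Integrable (Zinf φ L K 𝒞) P := by
  have : Nonempty (selections L 𝒞) := ⟨⟨_, cornerSelection_mem hL 𝒞⟩⟩
  have heq : Zinf φ L K 𝒞 =
      Finset.univ.inf' Finset.univ_nonempty fun f : selections L 𝒞 => Zf φ L K 𝒞 f.1 := by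
    funext ω
    rw [Finset.inf'_apply, Finset.inf'_univ_eq_ciInf]
    rfl
  rw [heq]
  refine Finset.inf'_induction (p := fun F : Ω → ℝ => Integrable F P) _ _
    (fun F hF G hG => hF.inf hG) fun f _ => ?_
  exact (hφ.memLp_Zf hd hL hK f.2).integrable (by norm_num)

/-- The corner selection serves as reference: it bounds Z above by a centred variable, and below
after subtracting the weighted oscillation majorants. No independence or union bound across boxes is
needed, because an infimum over selections splits box by box. -/
lemma exists_abs_integral_Zinf_le (hd : 3 ≤ d) : ∃ C : ℝ, 0 < C ∧
    ∀ (Ω : Type*) [MeasurableSpace Ω] (P : Measure Ω) [IsProbabilityMeasure P]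
      (φ : Lat d → Ω → ℝ), IsGaussianFreeField φ P → ∀ (L K : ℕ) (𝒞 : Finset (Lat d)), 1 ≤ L →
        100 ≤ K → IsWellSeparated L K 𝒞 →
          |∫ ω, Zinf φ L K 𝒞 ω ∂P| ≤ C / K * √((𝒞.card : ℝ) / capacity (boxUnion L 𝒞)) := by
  obtain ⟨C₁, hC₁, hosc⟩ := exists_oscillation_bound (d := d) hd
  obtain ⟨C₂, hC₂, hcapB⟩ := exists_capacity_boxB_le (d := d) hd
  refine ⟨C₁ * √C₂, by positivity, fun Ω _ P _ φ hφ L K 𝒞 hL hK h𝒞 => ?_⟩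
  have hL0 : (0 : ℝ) < L := by exact_mod_cast hL
  have hK0 : (0 : ℝ) < K := by
    have : (100 : ℝ) ≤ K := by exact_mod_cast hK
    linarith
  choose R hR1 hR2 hR3 using hosc Ω P φ hφ L K hL hK
  set f₀ : 𝒞 → Lat d := fun z i => z.1 i - 3 * L with hf₀
  have hf₀mem : f₀ ∈ selections L 𝒞 := cornerSelection_mem hL 𝒞
  have hne : Nonempty (selections L 𝒞) := ⟨⟨_, hf₀mem⟩⟩
  have hZ := hφ.integrable_Zinf hd hL hK 𝒞
  have hZ₀ : Integrable (Zf φ L K 𝒞 f₀) P := (hφ.memLp_Zf hd hL hK hf₀mem).integrable (by norm_num)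
  have hle : ∀ ω, Zinf φ L K 𝒞 ω ≤ Zf φ L K 𝒞 f₀ ω := fun ω =>
    ciInf_le (Set.finite_range _).bddBelow (⟨f₀, hf₀mem⟩ : selections L 𝒞)
  have hge : ∀ ω, Zf φ L K 𝒞 f₀ ω - ∑ z : 𝒞, weight L 𝒞 z.1 * R z.1 ω ≤ Zinf φ L K 𝒞 ω := by
    intro ω
    refine le_ciInf fun f => ?_
    rw [sub_le_iff_le_add', ← sub_le_iff_le_add]
    unfold Zf
    rw [← Finset.sum_sub_distrib]
    refine Finset.sum_le_sum fun z _ => ?_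
    rw [← mul_sub]
    exact mul_le_mul_of_nonneg_left (hR2 z.1 _ (selection_mem f.2 z) ω) (weight_nonneg _ _ _)
  have hRint : Integrable (fun ω => ∑ z : 𝒞, weight L 𝒞 z.1 * R z.1 ω) P :=
    integrable_finsetSum _ fun z _ => (hR1 z.1).const_mul _
  have h0 := hφ.integral_Zf hd hL hK hf₀mem
  have hup : ∫ ω, Zinf φ L K 𝒞 ω ∂P ≤ 0 := by
    rw [← h0]
    exact integral_mono hZ hZ₀ hle
  have hlow : -(C₁ / K * √(1 / (L : ℝ) ^ (d - 2))) ≤ ∫ ω, Zinf φ L K 𝒞 ω ∂P := by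
    have h1 := integral_mono (hZ₀.sub hRint) hZ hge
    have h2 : ∫ ω, (Zf φ L K 𝒞 f₀ - fun ω => ∑ z : 𝒞, weight L 𝒞 z.1 * R z.1 ω) ω ∂P =
        - ∑ z : 𝒞, weight L 𝒞 z.1 * ∫ ω, R z.1 ω ∂P := by
      rw [integral_sub' hZ₀ hRint, h0, zero_sub,
        integral_finsetSum _ fun z _ => (hR1 z.1).const_mul _]
      simp only [integral_const_mul]
    rw [h2] at h1
    have h3 : ∑ z : 𝒞, weight L 𝒞 z.1 * ∫ ω, R z.1 ω ∂P ≤ C₁ / K * √(1 / (L : ℝ) ^ (d - 2)) := by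
      calc _ ≤ ∑ z : 𝒞, weight L 𝒞 z.1 * (C₁ / K * √(1 / (L : ℝ) ^ (d - 2))) :=
            Finset.sum_le_sum fun z _ =>
              mul_le_mul_of_nonneg_left (hR3 z.1) (weight_nonneg _ _ _)
        _ = _ := by rw [← Finset.sum_mul, h𝒞.sum_weight hd hL hK, one_mul]
    linarith
  rw [abs_of_nonpos hup]
  have hcap := capacity_pos hd (h𝒞.boxUnion_nonempty hL)
  have hcaple : capacity (boxUnion L 𝒞) ≤ 𝒞.card * (C₂ * (L : ℝ) ^ (d - 2)) := by
    refine (capacity_biUnion_le 𝒞 (boxB L)).trans ?_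
    calc _ ≤ ∑ _z ∈ 𝒞, C₂ * (L : ℝ) ^ (d - 2) := Finset.sum_le_sum fun z _ => hcapB L z hL
      _ = _ := by simp
  calc -∫ ω, Zinf φ L K 𝒞 ω ∂P ≤ C₁ / K * √(1 / (L : ℝ) ^ (d - 2)) := by linarith
    _ ≤ C₁ / K * √(C₂ * (𝒞.card / capacity (boxUnion L 𝒞))) := by
        gcongr
        rw [mul_div_assoc', div_le_div_iff₀ (by positivity) hcap]
        linarith
    _ = _ := by
        rw [Real.sqrt_mul hC₂.le]; ring

end Field

end GFF

end

/-! ### Assembly of the two bounds -/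

theorem theorem4p2 (d : ℕ) [NeZero d] (hd : 3 ≤ d) :
    ∃ (α : ℕ → ℝ) (c₄ : ℝ),
      (∀ K, 100 ≤ K → 1 < α K) ∧ Tendsto α atTop (𝓝 1) ∧ 0 < c₄ ∧
      ∀ (Ω : Type*) [MeasurableSpace Ω] (P : Measure Ω) [IsProbabilityMeasure P]
        (φ : GFF.Lat d → Ω → ℝ), GFF.IsGaussianFreeField φ P →
        (∀ K : ℕ, 100 ≤ K →
          limsup (fun L : ℕ =>
            ⨆ (𝒞 : Finset (GFF.Lat d)) (_ : GFF.IsWellSeparated L K 𝒞)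
              (f : GFF.selections L 𝒞),
              evariance (GFF.Zf φ L K 𝒞 f.1) P *
                ENNReal.ofReal (GFF.capacity (GFF.boxUnion L 𝒞))) atTop
            < ENNReal.ofReal (α K)) ∧
        (∀ L K : ℕ, 1 ≤ L → 100 ≤ K → ∀ 𝒞 : Finset (GFF.Lat d), GFF.IsWellSeparated L K 𝒞 →
          Integrable (GFF.Zinf φ L K 𝒞) P ∧
          |∫ ω, GFF.Zinf φ L K 𝒞 ω ∂P| ≤
            c₄ / K * Real.sqrt ((𝒞.card : ℝ) / GFF.capacity (GFF.boxUnion L 𝒞))) := by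
  obtain ⟨C, hC, hvar⟩ := GFF.exists_integral_sq_Zf_le (d := d) hd
  obtain ⟨c₄, hc₄, hinf⟩ := GFF.exists_abs_integral_Zinf_le (d := d) hd
  -- The variance bound is 1 + C/K for every L ≥ 1; replacing C by C + 1 makes the inequality strict
  -- after the limsup.
  refine ⟨fun K => 1 + (C + 1) / K, c₄, fun K hK => ?_, ?_, hc₄, fun Ω _ P _ φ hφ => ⟨?_, ?_⟩⟩
  · have : (0 : ℝ) < K := by exact_mod_cast (by omega : 0 < K)
    have : 0 < (C + 1) / (K : ℝ) := by positivity
    linarith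
  · simpa using (tendsto_const_div_atTop_nhds_zero_nat (C + 1)).const_add 1
  · intro K hK
    have hK0 : (0 : ℝ) < K := by exact_mod_cast (by omega : 0 < K)
    refine lt_of_le_of_lt (b := ENNReal.ofReal (1 + C / K)) ?_ ?_
    · refine limsup_le_of_le (by isBoundedDefault) ?_
      filter_upwards [eventually_ge_atTop 1] with L hL
      refine iSup_le fun 𝒞 => iSup_le fun h𝒞 => iSup_le fun f => ?_
      have hmem := hφ.memLp_Zf hd hL hK f.2
      rw [← ofReal_variance hmem, variance_of_integral_eq_zero hmem.aestronglyMeasurable.aemeasurable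
        (hφ.integral_Zf hd hL hK f.2), ← ENNReal.ofReal_mul (integral_nonneg fun ω => sq_nonneg _)]
      exact ENNReal.ofReal_le_ofReal (hvar Ω P φ hφ L K 𝒞 hL hK h𝒞 f.1 f.2)
    · rw [ENNReal.ofReal_lt_ofReal_iff (by positivity)]
      have := div_lt_div_of_pos_right (lt_add_one C) hK0
      linarith
  · exact fun L K hL hK 𝒞 h𝒞 => ⟨hφ.integrable_Zinf hd hL hK 𝒞, hinf Ω P φ hφ L K 𝒞 hL hK h𝒞⟩
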